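/- Let $n\ge 3$ and let $\rho_1,\dots,\rho_n\in(0,1)$ satisfy $\sum_{i=1}^n\rho_i<1$. Let $D\subset\mathbb R$ be any dust-like self-similar set with contraction ratios $\rho_1,\dots,\rho_n$; that is, there are similitudes $\Phi_1,\dots,\Phi_n$ of $\mathbb R$, $\Phi_i$ having ratio $\rho_i$, such that $D$ is the nonempty compact set with $\bigcup_{i=1}^n\Phi_i(D)=D$, and $\Phi_i(D)\cap\Phi_j(D)=\emptyset$ for all $i\ne j$. Let $\Psi_i(x)=\rho_i x+t_i$ ($1\le i\le n$, $t_i\in\mathbb R$) be such that 1. the intervals $\Psi_1([0,1]),\dots,\Psi_n([0,1])$ are arranged from left to right with disjoint interiors; 2. $\Psi_1(0)=0$ and $\Psi_n(1)=1$; 3. $\Psi_i(1)=\Psi_{i+1}(0)$ for at least one $i\in\{1,\dots,n-1\}$; and let $T$ be the attractor of $\{\Psi_i\}_{i=1}^n$, i.e. the nonempty compact set with $\bigcup_{i=1}^n\Psi_i(T)=T$. If $\log\rho_i/\log\rho_j\in\mathbb Q$ for all $i,j\in\{1,\dots,n\}$, then $D$ and $T$ are Lipschitz equivalent: there are a bijection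 $f:D\to T$ and constants $c,c'>0$ such that $c|x-y|\le|f(x)-f(y)|\le c'|x-y|$ for all $x,y\in D$. -/

import Mathlib

/-- `E` and `F` are Lipschitz equivalent: there is a bijection `f` from `E` onto `F` with
`c |x - y| ≤ |f x - f y| ≤ c' |x - y|` on `E`, for some constants `c, c' > 0`. -/
def LipschitzEquivalent (E F : Set ℝ) : Prop :=
  ∃ f : E ≃ F, ∃ c c' : ℝ, 0 < c ∧ 0 < c' ∧
    ∀ x y : E, c * dist x y ≤ dist (f x) (f y) ∧ dist (f x) (f y) ≤ c' * dist x y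

/-- `f` is a similitude of the line with ratio `r` (orientation may be reversed). -/
def IsSimilitude (r : ℝ) (f : ℝ → ℝ) : Prop :=
  ∀ x y : ℝ, dist (f x) (f y) = r * dist x y

/-- `E` is the attractor of the family `φ`: the nonempty compact set with `⋃ i, φ i (E) = E`. -/
structure IsAttractor {n : ℕ} (φ : Fin n → ℝ → ℝ) (E : Set ℝ) : Prop where
  nonempty : E.Nonempty
  isCompact : IsCompact E
  iUnion_image_eq : ⋃ i, φ i '' E = E

/-- `ρ` is a (separable) contraction vector in the line. -/
structure IsContractionVector {n : ℕ} (ρ : Fin n → ℝ) : Prop where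
  pos : ∀ i, 0 < ρ i
  lt_one : ∀ i, ρ i < 1
  sum_lt_one : ∑ i, ρ i < 1

/-- `D` is a dust-like self-similar set in the line with contraction vector `ρ`: the attractor of
similitudes with ratios `ρ i`, satisfying the strong separation condition. -/
def IsDustLike {n : ℕ} (ρ : Fin n → ℝ) (D : Set ℝ) : Prop :=
  ∃ φ : Fin n → ℝ → ℝ, (∀ i, IsSimilitude (ρ i) (φ i)) ∧ IsAttractor φ D ∧
    ∀ i j, i ≠ j → Disjoint (φ i '' D) (φ j '' D)

/-- The maps `x ↦ ρ i * x + t i`. -/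
def affineMaps {n : ℕ} (ρ t : Fin n → ℝ) (i : Fin n) (x : ℝ) : ℝ :=
  ρ i * x + t i

/-- The intervals `ψ i [0,1] = [ψ i 0, ψ i 1]`, where `ψ i x = ρ i * x + t i` and `ρ i > 0`, are
arranged from left to right without overlapping, the first one starts at `0`, the last one ends
at `1`, and at least two consecutive ones touch. -/
structure IsTouchingArrangement {n : ℕ} (ρ t : Fin n → ℝ) : Prop where
  ordered : ∀ i j : Fin n, i < j → affineMaps ρ t i 1 ≤ affineMaps ρ t j 0
  first : ∀ i : Fin n, (i : ℕ) = 0 → affineMaps ρ t i 0 = 0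
  last : ∀ i : Fin n, (i : ℕ) + 1 = n → affineMaps ρ t i 1 = 1
  touching : ∃ i j : Fin n, (j : ℕ) = (i : ℕ) + 1 ∧ affineMaps ρ t i 1 = affineMaps ρ t j 0

/-! Commensurable logarithms make every ratio a power `r ^ k i` of one number, so pieces of both
sets carry integer weights. At scale `r ^ K`, cut both sets into the pieces of the words that first
reach weight `K`. Pieces of `D` at this scale are separated by a multiple of `r ^ K`; pieces of `T`
are either separated in the same way or touch at an endpoint. The identity on words therefore fails
only at touching pieces, which are adjacent in `T` but may be far apart in `D`.

The remedy is to alter the coding. As the lengths sum to less than one, some consecutive first-level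
intervals leave a gap. Let the left part of a piece be the subpieces before this gap. When `u` and
`v` touch, the left part of `v ⊥ ... ⊥`, the end of `v` next to the touching point, is exchanged
with an equally large left part deep inside `u` that has gaps on both sides. Words on either side of
the touching point then both descend from `u` (`ExchangeData.exists_common_prefix`). Equal size is
the equation `weight_eq`, solved in `IsArrangement.nonempty_exchangeData`.

Performing the exchanges at the levels `K = κ * step` gives weight-preserving bijections `Matching
κ` between the pieces of `T` and those of `D`. Close pieces of `D` have matched pieces close in `T`,
because they coincide; close pieces of `T` have matched pieces with a common ancestor one level up.
An exchange moves pieces only between touching ones, so successive matchings differ by a multiple of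
the mesh and converge to a bi-Lipschitz bijection (`lipschitzEquivalent_of_correspondences`). -/

open Filter Topology

/-! ### Lipschitz maps as limits of correspondences -/

/-- The scale at which two points at distance `d` get separated by a geometric sequence of
thresholds. -/
theorem exists_separating_scale {c q d : ℝ} (hc : 0 < c) (hq1 : q < 1) (hd : 0 < d) :
    ∃ k : ℕ, c * q ^ (k + 1) ≤ d ∧ (k = 0 ∨ d < c * q ^ k) := by
  classical
  have hex : ∃ m : ℕ, c * q ^ m ≤ d := by
    obtain ⟨m, hm⟩ := exists_pow_lt_of_lt_one (div_pos hd hc) hq1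
    refine ⟨m, ?_⟩
    rw [lt_div_iff₀ hc] at hm
    linarith [mul_comm c (q ^ m)]
  rcases h : Nat.find hex with _ | m
  · refine ⟨0, ?_, Or.inl rfl⟩
    have h0 := Nat.find_spec hex
    rw [h] at h0
    refine le_trans ?_ h0
    rw [zero_add, pow_one, pow_zero]
    gcongr
  · refine ⟨m, ?_, Or.inr ?_⟩
    · have h0 := Nat.find_spec hex
      rwa [h] at h0
    · exact not_le.1 (Nat.find_min hex (by omega))

/-- A sequence of approximate correspondences from `E` to a closed set `F`, of geometrically
decreasing mesh, converges to a Lipschitz map. -/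
theorem exists_lipschitz_limit {E F : Set ℝ} (hF : IsClosed F) {S : ℕ → ℝ → ℝ → Prop}
    {c C q : ℝ} (hc : 0 < c) (hC : 0 < C) (hq0 : 0 < q) (hq1 : q < 1)
    (mem : ∀ k x y, S k x y → x ∈ E ∧ y ∈ F)
    (total : ∀ k, ∀ x ∈ E, ∃ y, S k x y)
    (near : ∀ k x y x' y', S k x y → S k x' y' → (k = 0 ∨ |x - x'| < c * q ^ k) →
      |y - y'| ≤ C * q ^ k)
    (step : ∀ k x y y', S k x y → S (k + 1) x y' → |y - y'| ≤ C * q ^ k) :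
    ∃ (f : ℝ → ℝ) (L A : ℝ), 0 < L ∧ (∀ x ∈ E, f x ∈ F) ∧
      (∀ x ∈ E, ∀ x' ∈ E, |f x - f x'| ≤ L * |x - x'|) ∧
      (∀ k x y, S k x y → |y - f x| ≤ A * q ^ k) := by
  classical
  have hq1' : 0 < 1 - q := by linarith
  have key : ∀ x : ℝ, ∃ z : ℝ, x ∈ E → z ∈ F ∧ ∀ k y, S k x y →
      |y - z| ≤ (C + C / (1 - q)) * q ^ k := by
    intro x
    by_cases hx : x ∈ E
    · choose Y hY using fun k => total k x hx
      have hstep : ∀ k, dist (Y k) (Y (k + 1)) ≤ C * q ^ k := fun k => by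
        rw [Real.dist_eq]; exact step k x _ _ (hY k) (hY (k + 1))
      obtain ⟨z, hz⟩ := cauchySeq_tendsto_of_complete (cauchySeq_of_le_geometric q C hq1 hstep)
      refine ⟨z, fun _ => ⟨hF.mem_of_tendsto hz (Eventually.of_forall fun k => (mem k _ _ (hY k)).2),
        fun k y hy => ?_⟩⟩
      have h1 := dist_le_of_le_geometric_of_tendsto q C hq1 hstep hz k
      rw [Real.dist_eq] at h1
      have h2 : |y - Y k| ≤ C * q ^ k := near k x y x (Y k) hy (hY k)
        (Or.inr (by simpa using mul_pos hc (pow_pos hq0 k)))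
      calc |y - z| ≤ |y - Y k| + |Y k - z| := abs_sub_le _ _ _
        _ ≤ C * q ^ k + C * q ^ k / (1 - q) := add_le_add h2 h1
        _ = _ := by ring
    · exact ⟨0, fun h => absurd h hx⟩
  choose f hf using key
  set A := C + C / (1 - q) with hA
  have hA0 : 0 < A := by positivity
  refine ⟨f, (2 * A + C) / (c * q), A, by positivity, fun x hx => (hf x hx).1, ?_,
    fun k x y hxy => (hf x (mem k x y hxy).1).2 k y hxy⟩
  intro x hx x' hx'
  rcases eq_or_ne x x' with rfl | hne
  · simp
  obtain ⟨k, hk1, hk2⟩ := exists_separating_scale hc hq1 (abs_pos.2 (sub_ne_zero.2 hne))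
  obtain ⟨y, hy⟩ := total k x hx
  obtain ⟨y', hy'⟩ := total k x' hx'
  have h1 := (hf x hx).2 k y hy
  have h2 := (hf x' hx').2 k y' hy'
  have h3 := near k x y x' y' hy hy' hk2
  have h4 : |f x - f x'| ≤ (2 * A + C) * q ^ k := by
    rw [abs_le] at *
    constructor <;> nlinarith
  calc |f x - f x'| ≤ (2 * A + C) * q ^ k := h4
    _ = (2 * A + C) / (c * q) * (c * q ^ (k + 1)) := by field_simp; ring
    _ ≤ _ := by gcongr

/-- Two compact sets related by a sequence of approximate bijective correspondences of
geometrically decreasing mesh are Lipschitz equivalent. -/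
theorem lipschitzEquivalent_of_correspondences {E F : Set ℝ} (hE : IsClosed E) (hF : IsClosed F)
    {S : ℕ → ℝ → ℝ → Prop}
    {c C q : ℝ} (hc : 0 < c) (hC : 0 < C) (hq0 : 0 < q) (hq1 : q < 1)
    (mem : ∀ k x y, S k x y → x ∈ E ∧ y ∈ F)
    (total : ∀ k, ∀ x ∈ E, ∃ y, S k x y) (total' : ∀ k, ∀ y ∈ F, ∃ x, S k x y)
    (near : ∀ k x y x' y', S k x y → S k x' y' → (k = 0 ∨ |x - x'| < c * q ^ k) →
      |y - y'| ≤ C * q ^ k)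
    (near' : ∀ k x y x' y', S k x y → S k x' y' → (k = 0 ∨ |y - y'| < c * q ^ k) →
      |x - x'| ≤ C * q ^ k)
    (step : ∀ k x y y', S k x y → S (k + 1) x y' → |y - y'| ≤ C * q ^ k)
    (step' : ∀ k x x' y, S k x y → S (k + 1) x' y → |x - x'| ≤ C * q ^ k) :
    LipschitzEquivalent E F := by
  obtain ⟨f, L, A, hL, hfF, hfL, hfS⟩ :=
    exists_lipschitz_limit hF hc hC hq0 hq1 mem total near step
  obtain ⟨g, L', A', hL', hgE, hgL, hgS⟩ :=
    exists_lipschitz_limit (S := fun k y x => S k x y) hE hc hC hq0 hq1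
      (fun k y x h => (mem k x y h).symm) total'
      (fun k y x y' x' h h' hd => near' k x y x' y' h h' hd)
      (fun k y x x' h h' => step' k x x' y h h')
  have hpow : Tendsto (fun k : ℕ => q ^ k) atTop (𝓝 0) :=
    tendsto_pow_atTop_nhds_zero_of_lt_one hq0.le hq1
  have hgf : ∀ x ∈ E, g (f x) = x := by
    intro x hx
    -- If `y` is related to `x` at stage `k`, then `f x` is close to `y` and `g y` is close to `x`,
    -- with errors of order `q ^ k`.
    have hb : ∀ k : ℕ, |g (f x) - x| ≤ (L' * A + A') * q ^ k := by
      intro k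
      obtain ⟨y, hy⟩ := total k x hx
      have h1 := hfS k x y hy
      have h2 := hgS k y x hy
      have h3 := hgL (f x) (hfF x hx) y (mem k x y hy).2
      rw [abs_sub_comm (f x)] at h3
      calc |g (f x) - x| ≤ |g (f x) - g y| + |g y - x| := abs_sub_le _ _ _
        _ ≤ L' * (A * q ^ k) + A' * q ^ k := by
          rw [abs_sub_comm (g y)]
          exact add_le_add (h3.trans (by gcongr)) h2
        _ = _ := by ring
    have h0 := ge_of_tendsto' (hpow.const_mul (L' * A + A')) hb
    rw [mul_zero] at h0
    exact sub_eq_zero.1 (abs_eq_zero.1 (le_antisymm h0 (abs_nonneg _)))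
  have hfg : ∀ y ∈ F, f (g y) = y := by
    intro y hy
    have hb : ∀ k : ℕ, |f (g y) - y| ≤ (L * A' + A) * q ^ k := by
      intro k
      obtain ⟨x, hx⟩ := total' k y hy
      have h1 := hfS k x y hx
      have h2 := hgS k y x hx
      have h3 := hfL (g y) (hgE y hy) x (mem k x y hx).1
      rw [abs_sub_comm (g y)] at h3
      calc |f (g y) - y| ≤ |f (g y) - f x| + |f x - y| := abs_sub_le _ _ _
        _ ≤ L * (A' * q ^ k) + A * q ^ k := by
          rw [abs_sub_comm (f x)]
          exact add_le_add (h3.trans (by gcongr)) h1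
        _ = _ := by ring
    have h0 := ge_of_tendsto' (hpow.const_mul (L * A' + A)) hb
    rw [mul_zero] at h0
    exact sub_eq_zero.1 (abs_eq_zero.1 (le_antisymm h0 (abs_nonneg _)))
  refine ⟨⟨fun x => ⟨f x, hfF x x.2⟩, fun y => ⟨g y, hgE y y.2⟩, fun x => Subtype.ext (hgf x x.2),
    fun y => Subtype.ext (hfg y y.2)⟩, 1 / L', L, by positivity, hL, fun x y => ?_⟩
  simp only [Equiv.coe_fn_mk, Subtype.dist_eq, Real.dist_eq]
  refine ⟨?_, hfL x x.2 y y.2⟩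
  have h := hgL (f x) (hfF x x.2) (f y) (hfF y y.2)
  rw [hgf x x.2, hgf y y.2] at h
  rw [one_div, inv_mul_le_iff₀ hL']
  exact h

/-! ### Words, cuts by weight, and compositions along words -/

section Words

variable {ι : Type*}

/-- The total weight of the letters of a word. -/
def wordWeight (k : ι → ℕ) (w : List ι) : ℕ := (w.map k).sum

@[simp] theorem wordWeight_nil (k : ι → ℕ) : wordWeight k [] = 0 := rfl

@[simp] theorem wordWeight_cons (k : ι → ℕ) (a : ι) (w : List ι) :
    wordWeight k (a :: w) = k a + wordWeight k w := by simp [wordWeight]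

@[simp] theorem wordWeight_append (k : ι → ℕ) (u v : List ι) :
    wordWeight k (u ++ v) = wordWeight k u + wordWeight k v := by simp [wordWeight]

@[simp] theorem wordWeight_replicate (k : ι → ℕ) (m : ℕ) (a : ι) :
    wordWeight k (List.replicate m a) = m * k a := by simp [wordWeight]

theorem length_le_wordWeight {k : ι → ℕ} (hk : ∀ a, 0 < k a) (w : List ι) :
    w.length ≤ wordWeight k w := by
  induction w with
  | nil => simp
  | cons a w ih => have := hk a; simp; omega

/-- The words whose weight is at least `K`, all of whose proper prefixes have weight less
than `K`. -/
def IsCut (k : ι → ℕ) (K : ℕ) (w : List ι) : Prop :=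
  K ≤ wordWeight k w ∧ ∀ p s, w = p ++ s → s ≠ [] → wordWeight k p < K

theorem exists_isCut_prefix {k : ι → ℕ} {K : ℕ} (w : List ι) (hw : K ≤ wordWeight k w) :
    ∃ u y, w = u ++ y ∧ IsCut k K u := by
  induction w using List.reverseRecOn with
  | nil => exact ⟨[], [], rfl, hw, fun p s h hs => by simp at h; exact absurd h.2 hs⟩
  | append_singleton l a ih =>
    by_cases h : K ≤ wordWeight k l
    · obtain ⟨u, y, rfl, hu⟩ := ih h
      exact ⟨u, y ++ [a], by simp, hu⟩
    · refine ⟨l ++ [a], [], by simp, hw, fun p s hps hs => ?_⟩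
      rcases List.append_eq_append_iff.1 hps with ⟨as, rfl, h2⟩ | ⟨bs, rfl, -⟩
      · rcases as with _ | ⟨b, as⟩
        · simpa using h
        · simp at h2
          exact absurd h2.2.2 hs
      · simp at h
        omega

/-- Cut words form a prefix-free set, so a word has at most one ancestor at a given level. All
uniqueness of exchanges and matchings rests on this. -/
theorem IsCut.eq_of_append_eq {k : ι → ℕ} {K : ℕ} {u u' y y' : List ι} (hu : IsCut k K u)
    (hu' : IsCut k K u') (h : u ++ y = u' ++ y') : u = u' ∧ y = y' := by
  rcases List.append_eq_append_iff.1 h with ⟨s, rfl, h2⟩ | ⟨s, rfl, h2⟩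
  · rcases eq_or_ne s [] with rfl | hs
    · simpa using h2
    · exact absurd (hu'.2 u s rfl hs) (not_lt.2 hu.1)
  · rcases eq_or_ne s [] with rfl | hs
    · simpa using h2.symm
    · exact absurd (hu.2 u' s rfl hs) (not_lt.2 hu'.1)

theorem IsCut.wordWeight_le {k : ι → ℕ} {K M : ℕ} (hM : ∀ a, k a ≤ M) {u : List ι}
    (hu : IsCut k K u) : wordWeight k u ≤ K + M := by
  rcases List.eq_nil_or_concat u with rfl | ⟨l, a, rfl⟩
  · simp
  · have h1 := hu.2 l [a] (by simp) (by simp)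
    have := hM a
    simp
    omega

/-- A nonempty `x` makes `q` a proper prefix, so `q` and hence `q'` weigh less than `K`; longer
proper prefixes keep their weight under the replacement. -/
theorem IsCut.replace_prefix {k : ι → ℕ} {K : ℕ} {q q' x : List ι} (h : IsCut k K (q ++ x))
    (hq : wordWeight k q = wordWeight k q') (hx : x ≠ []) : IsCut k K (q' ++ x) := by
  refine ⟨by simpa [hq] using h.1, fun p s hps hs => ?_⟩
  rcases List.append_eq_append_iff.1 hps with ⟨as, rfl, rfl⟩ | ⟨bs, rfl, -⟩
  · have := h.2 (q ++ as) s (by simp) hs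
    simpa [hq] using this
  · have := h.2 q x rfl hx
    simp at hq
    omega

theorem isCut_zero_iff {k : ι → ℕ} {w : List ι} : IsCut k 0 w ↔ w = [] := by
  refine ⟨fun h => ?_, fun h => ?_⟩
  · by_contra hw
    exact absurd (h.2 [] w rfl hw) (by simp)
  · subst h
    exact ⟨by simp, fun p s h hs => by simp at h; exact absurd h.2 hs⟩

theorem List.comparable_or_split (w w' : List ι) : (∃ s, w' = w ++ s) ∨ (∃ s, w = w' ++ s) ∨
    ∃ c a b y y', a ≠ b ∧ w = c ++ a :: y ∧ w' = c ++ b :: y' := by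
  induction w generalizing w' with
  | nil => exact Or.inl ⟨w', rfl⟩
  | cons a w ih =>
    rcases w' with _ | ⟨b, w'⟩
    · exact Or.inr (Or.inl ⟨a :: w, rfl⟩)
    · by_cases hab : a = b
      · subst hab
        rcases ih w' with ⟨s, rfl⟩ | ⟨s, rfl⟩ | ⟨c, x, x', y, y', h, rfl, rfl⟩
        · exact Or.inl ⟨s, rfl⟩
        · exact Or.inr (Or.inl ⟨s, rfl⟩)
        · exact Or.inr (Or.inr ⟨a :: c, x, x', y, y', h, rfl, rfl⟩)
      · exact Or.inr (Or.inr ⟨[], a, b, w, w', hab, rfl, rfl⟩)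

theorem IsCut.exists_split {k : ι → ℕ} {K : ℕ} {u u' : List ι} (hu : IsCut k K u)
    (hu' : IsCut k K u') (h : u ≠ u') :
    ∃ c a b y y', a ≠ b ∧ u = c ++ a :: y ∧ u' = c ++ b :: y' := by
  rcases List.comparable_or_split u u' with ⟨s, hs⟩ | ⟨s, hs⟩ | h'
  · exact absurd (hu'.eq_of_append_eq hu (by simpa using hs : u' ++ [] = u ++ s)).1.symm h
  · exact absurd (hu.eq_of_append_eq hu' (by simpa using hs : u ++ [] = u' ++ s)).1 h
  · exact h'

/-- The composition of the maps `f a` along a word, the first letter being the outermost map. -/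
def wordMap (f : ι → ℝ → ℝ) : List ι → ℝ → ℝ
  | [], x => x
  | a :: w, x => f a (wordMap f w x)

@[simp] theorem wordMap_nil (f : ι → ℝ → ℝ) (x : ℝ) : wordMap f [] x = x := rfl

@[simp] theorem wordMap_cons (f : ι → ℝ → ℝ) (a : ι) (w : List ι) (x : ℝ) :
    wordMap f (a :: w) x = f a (wordMap f w x) := rfl

@[simp] theorem wordMap_append (f : ι → ℝ → ℝ) (u v : List ι) (x : ℝ) :
    wordMap f (u ++ v) x = wordMap f u (wordMap f v x) := by
  induction u with
  | nil => rfl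
  | cons a u ih => simp [ih]

theorem dist_wordMap {f : ι → ℝ → ℝ} {r : ℝ} {k : ι → ℕ} (hf : ∀ a, IsSimilitude (r ^ k a) (f a))
    (w : List ι) (x y : ℝ) :
    |wordMap f w x - wordMap f w y| = r ^ wordWeight k w * |x - y| := by
  induction w with
  | nil => simp
  | cons a w ih =>
    have := hf a (wordMap f w x) (wordMap f w y)
    rw [Real.dist_eq, Real.dist_eq] at this
    simp [this, ih, pow_add, mul_assoc]

theorem wordMap_mem {f : ι → ℝ → ℝ} {E : Set ℝ} (hE : ⋃ i, f i '' E = E) (w : List ι) {x : ℝ}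
    (hx : x ∈ E) : wordMap f w x ∈ E := by
  induction w with
  | nil => exact hx
  | cons a w ih =>
    rw [← hE]
    exact Set.mem_iUnion.2 ⟨a, _, ih, rfl⟩

theorem exists_word_of_mem {f : ι → ℝ → ℝ} {E : Set ℝ} (hE : ⋃ i, f i '' E = E) (m : ℕ) {x : ℝ}
    (hx : x ∈ E) : ∃ w : List ι, w.length = m ∧ x ∈ wordMap f w '' E := by
  induction m generalizing x with
  | zero => exact ⟨[], rfl, x, hx, rfl⟩
  | succ m ih =>
    rw [← hE] at hx
    obtain ⟨a, y, hy, rfl⟩ := Set.mem_iUnion.1 hx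
    obtain ⟨w, hw, z, hz, rfl⟩ := ih hy
    exact ⟨a :: w, by simp [hw], z, hz, rfl⟩

theorem mem_image_wordMap_of_append {f : ι → ℝ → ℝ} {E : Set ℝ} (hE : ⋃ i, f i '' E = E)
    {u y : List ι} {x : ℝ} (hx : x ∈ wordMap f (u ++ y) '' E) : x ∈ wordMap f u '' E := by
  obtain ⟨z, hz, rfl⟩ := hx
  exact ⟨wordMap f y z, wordMap_mem hE y hz, by simp⟩

theorem exists_isCut_of_mem {f : ι → ℝ → ℝ} {E : Set ℝ} (hE : ⋃ i, f i '' E = E) {k : ι → ℕ}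
    (hk : ∀ a, 0 < k a) (K : ℕ) {x : ℝ} (hx : x ∈ E) :
    ∃ w, IsCut k K w ∧ x ∈ wordMap f w '' E := by
  obtain ⟨w, hw, hxw⟩ := exists_word_of_mem hE K hx
  obtain ⟨u, y, rfl, hu⟩ := exists_isCut_prefix (k := k) w (hw ▸ length_le_wordWeight hk w)
  exact ⟨u, hu, mem_image_wordMap_of_append hE hxw⟩

end Words

/-! ### Geometry of the touching set: gaps and contacts between pieces -/

section Arrangement

variable {ι : Type*}

/-- The maps `x ↦ r ^ k i * x + t i`. -/
def affineFamily (r : ℝ) (k : ι → ℕ) (t : ι → ℝ) (i : ι) (x : ℝ) : ℝ := r ^ k i * x + t i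

theorem wordMap_affineFamily_sub (r : ℝ) (k : ι → ℕ) (t : ι → ℝ) (w : List ι) (x y : ℝ) :
    wordMap (affineFamily r k t) w x - wordMap (affineFamily r k t) w y =
      r ^ wordWeight k w * (x - y) := by
  induction w with
  | nil => simp
  | cons a w ih =>
    simp only [wordMap_cons, affineFamily, wordWeight_cons, pow_add]
    linear_combination r ^ k a * ih

/-- The position of the intervals of two words which first differ at the letters `a < b`. -/
theorem wordMap_split_sub (r : ℝ) (k : ι → ℕ) (t : ι → ℝ) (c : List ι) (a b : ι) (y y' : List ι) :
    wordMap (affineFamily r k t) (c ++ b :: y') 0 - wordMap (affineFamily r k t) (c ++ a :: y) 1 =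
      r ^ wordWeight k (c ++ [a]) * (1 - wordMap (affineFamily r k t) y 1) +
      r ^ wordWeight k c * (t b - (r ^ k a + t a)) +
      r ^ wordWeight k (c ++ [b]) * wordMap (affineFamily r k t) y' 0 := by
  simp only [wordMap_append, wordMap_cons]
  rw [wordMap_affineFamily_sub]
  simp only [affineFamily, wordWeight_append, wordWeight_cons, wordWeight_nil, pow_add]
  ring

theorem isSimilitude_affineFamily {r : ℝ} (hr : 0 < r) (k : ι → ℕ) (t : ι → ℝ) (a : ι) :
    IsSimilitude (r ^ k a) (affineFamily r k t a) := by
  intro x y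
  rw [Real.dist_eq, Real.dist_eq, affineFamily, affineFamily, add_sub_add_right_eq_sub, ← mul_sub,
    abs_mul, abs_of_pos (pow_pos hr _)]

/-- Two words touch if the right end of the interval of the first is the left end of the interval
of the second. -/
def Touch (r : ℝ) (k : ι → ℕ) (t : ι → ℝ) (w w' : List ι) : Prop :=
  wordMap (affineFamily r k t) w 1 = wordMap (affineFamily r k t) w' 0

variable [LinearOrder ι] [BoundedOrder ι]

/-- The intervals `[t i, r ^ k i + t i]` are arranged from left to right without overlapping in
`[0, 1]`, the first one starting at `0` and the last one ending at `1`. -/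
structure IsArrangement (r : ℝ) (k : ι → ℕ) (t : ι → ℝ) : Prop where
  pos : 0 < r
  lt_one : r < 1
  weight_pos : ∀ a, 0 < k a
  ordered : ∀ a b, a < b → r ^ k a + t a ≤ t b
  first : t ⊥ = 0
  last : r ^ k ⊤ + t ⊤ = 1

namespace IsArrangement

variable {r : ℝ} {k : ι → ℕ} {t : ι → ℝ}

theorem translation_nonneg (h : IsArrangement r k t) (a : ι) : 0 ≤ t a := by
  rcases eq_or_ne a ⊥ with rfl | ha
  · exact h.first.ge
  · have h1 := h.ordered ⊥ a (bot_lt_iff_ne_bot.2 ha)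
    have h2 := pow_pos h.pos (k ⊥)
    have := h.first
    linarith

theorem right_end_le_one (h : IsArrangement r k t) (a : ι) : r ^ k a + t a ≤ 1 := by
  rcases eq_or_ne a ⊤ with rfl | ha
  · exact h.last.le
  · have h1 := h.ordered a ⊤ (lt_top_iff_ne_top.2 ha)
    have h2 := pow_pos h.pos (k ⊤)
    have := h.last
    linarith

theorem wordMap_mono (h : IsArrangement r k t) (w : List ι) {x y : ℝ} (hxy : x ≤ y) :
    wordMap (affineFamily r k t) w x ≤ wordMap (affineFamily r k t) w y := by
  have h1 := wordMap_affineFamily_sub r k t w y x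
  have h2 := mul_nonneg (pow_pos h.pos (wordWeight k w)).le (sub_nonneg.2 hxy)
  linarith

theorem wordMap_zero_lt_one (h : IsArrangement r k t) (w : List ι) :
    wordMap (affineFamily r k t) w 0 < wordMap (affineFamily r k t) w 1 := by
  have h1 := wordMap_affineFamily_sub r k t w 1 0
  have h2 := pow_pos h.pos (wordWeight k w)
  linarith

theorem wordMap_mem_Icc (h : IsArrangement r k t) (w : List ι) {x : ℝ} (hx : x ∈ Set.Icc (0 : ℝ) 1) :
    wordMap (affineFamily r k t) w x ∈ Set.Icc (0 : ℝ) 1 := by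
  induction w with
  | nil => exact hx
  | cons a w ih =>
    have h1 := h.translation_nonneg a
    have h2 := h.right_end_le_one a
    have h3 := pow_pos h.pos (k a)
    simp only [wordMap_cons, affineFamily, Set.mem_Icc] at ih ⊢
    constructor
    · have := mul_nonneg h3.le ih.1
      linarith
    · have := mul_le_mul_of_nonneg_left ih.2 h3.le
      linarith

theorem wordMap_replicate_top (h : IsArrangement r k t) (l : ℕ) :
    wordMap (affineFamily r k t) (List.replicate l ⊤) 1 = 1 := by
  induction l with
  | zero => rfl
  | succ l ih => simp [List.replicate_succ, ih, affineFamily, h.last]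

theorem wordMap_replicate_bot (h : IsArrangement r k t) (l : ℕ) :
    wordMap (affineFamily r k t) (List.replicate l ⊥) 0 = 0 := by
  induction l with
  | zero => rfl
  | succ l ih => simp [List.replicate_succ, ih, affineFamily, h.first]

/-- At the first letter other than `⊤`, a sibling interval with last letter `⊤` lies to the right,
and its length is the lower bound. -/
theorem eq_replicate_top_or_le (h : IsArrangement r k t) {M : ℕ} (hM : ∀ a, k a ≤ M) (w : List ι) :
    (∃ l, w = List.replicate l ⊤) ∨
      r ^ (wordWeight k w + M) ≤ 1 - wordMap (affineFamily r k t) w 1 := by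
  induction w with
  | nil => exact Or.inl ⟨0, rfl⟩
  | cons a w ih =>
    have hle := (h.wordMap_mem_Icc w (x := 1) (by simp)).2
    have hka := pow_pos h.pos (k a)
    by_cases ha : a = ⊤
    · subst ha
      rcases ih with ⟨l, rfl⟩ | ih
      · exact Or.inl ⟨l + 1, rfl⟩
      · right
        have h1 := mul_le_mul_of_nonneg_left ih hka.le
        have h2 := h.last
        simp only [wordMap_cons, affineFamily, wordWeight_cons]
        rw [add_assoc, pow_add]
        linarith
    · right
      have h1 := h.ordered a ⊤ (lt_top_iff_ne_top.2 ha)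
      have h2 := h.last
      have h3 : r ^ (wordWeight k (a :: w) + M) ≤ r ^ k ⊤ :=
        pow_le_pow_of_le_one h.pos.le h.lt_one.le (by have := hM ⊤; omega)
      have h4 := mul_le_mul_of_nonneg_left hle hka.le
      simp only [wordMap_cons, affineFamily]
      linarith

theorem eq_replicate_bot_or_le (h : IsArrangement r k t) {M : ℕ} (hM : ∀ a, k a ≤ M) (w : List ι) :
    (∃ l, w = List.replicate l ⊥) ∨
      r ^ (wordWeight k w + M) ≤ wordMap (affineFamily r k t) w 0 := by
  induction w with
  | nil => exact Or.inl ⟨0, rfl⟩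
  | cons a w ih =>
    have hle := (h.wordMap_mem_Icc w (x := 0) (by simp)).1
    have hka := pow_pos h.pos (k a)
    by_cases ha : a = ⊥
    · subst ha
      rcases ih with ⟨l, rfl⟩ | ih
      · exact Or.inl ⟨l + 1, rfl⟩
      · right
        have h1 := mul_le_mul_of_nonneg_left ih hka.le
        have h2 := h.first
        simp only [wordMap_cons, affineFamily, wordWeight_cons]
        rw [add_assoc, pow_add]
        linarith
    · right
      have h1 := h.ordered ⊥ a (bot_lt_iff_ne_bot.2 ha)
      have h2 := h.first
      have h3 : r ^ (wordWeight k (a :: w) + M) ≤ r ^ k ⊥ :=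
        pow_le_pow_of_le_one h.pos.le h.lt_one.le (by have := hM ⊥; omega)
      have h4 := mul_nonneg hka.le hle
      simp only [wordMap_cons, affineFamily]
      linarith

theorem split_le (h : IsArrangement r k t) (c : List ι) {a b : ι} (hab : a < b) (y y' : List ι) :
    wordMap (affineFamily r k t) (c ++ a :: y) 1 ≤
      wordMap (affineFamily r k t) (c ++ b :: y') 0 := by
  have h0 := wordMap_split_sub r k t c a b y y'
  have h1 := mul_nonneg (pow_pos h.pos (wordWeight k (c ++ [a]))).le
    (sub_nonneg.2 (h.wordMap_mem_Icc y (x := 1) (by simp)).2)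
  have h2 := mul_nonneg (pow_pos h.pos (wordWeight k c)).le (sub_nonneg.2 (h.ordered a b hab))
  have h3 := mul_nonneg (pow_pos h.pos (wordWeight k (c ++ [b]))).le
    (h.wordMap_mem_Icc y' (x := 0) (by simp)).1
  linarith

/-- By `wordMap_split_sub` the gap is a sum of three nonnegative terms. Either all vanish, which
forces the tails to be constant, or one of them is comparable to `r ^ K`. -/
theorem exists_split_gap [Finite ι] (h : IsArrangement r k t) : ∃ η : ℝ, 0 < η ∧
    ∀ (K : ℕ) (c : List ι) (a b : ι) (y y' : List ι), a < b →
      IsCut k K (c ++ a :: y) → IsCut k K (c ++ b :: y') →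
      (r ^ k a + t a = t b ∧ (∃ l, y = List.replicate l ⊤) ∧ (∃ l, y' = List.replicate l ⊥)) ∨
      η * r ^ K ≤ wordMap (affineFamily r k t) (c ++ b :: y') 0 -
        wordMap (affineFamily r k t) (c ++ a :: y) 1 := by
  obtain ⟨M, hM⟩ : ∃ M, ∀ a, k a ≤ M := by
    obtain ⟨M, hM⟩ := (Set.finite_range k).bddAbove
    exact ⟨M, fun a => hM ⟨a, rfl⟩⟩
  obtain ⟨δ, hδ, hδ'⟩ : ∃ δ : ℝ, 0 < δ ∧ ∀ a b, a < b → r ^ k a + t a = t b ∨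
      δ ≤ t b - (r ^ k a + t a) := by
    have hev : ∀ p : ι × ι, ∃ δ : ℝ, 0 < δ ∧ (p.1 < p.2 → r ^ k p.1 + t p.1 = t p.2 ∨
        δ ≤ t p.2 - (r ^ k p.1 + t p.1)) := by
      intro p
      by_cases hp : 0 < t p.2 - (r ^ k p.1 + t p.1)
      · exact ⟨_, hp, fun _ => Or.inr le_rfl⟩
      · refine ⟨1, one_pos, fun hlt => Or.inl ?_⟩
        have := h.ordered _ _ hlt
        linarith
    choose δ hδ0 hδ using hev
    have : Nonempty (ι × ι) := ⟨(⊥, ⊥)⟩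
    obtain ⟨p, hp⟩ := Finite.exists_min δ
    refine ⟨δ p, hδ0 p, fun a b hab => (hδ (a, b) hab).imp id fun h => (hp (a, b)).trans h⟩
  have hrM := pow_pos h.pos (2 * M)
  -- A cut word weighs at most `K + M`, and the end estimates lose another `M`; hence the exponent
  -- `2 * M`.
  refine ⟨min δ (r ^ (2 * M)), lt_min hδ hrM, fun K c a b y y' hab hw hw' => ?_⟩
  have hrK := pow_pos h.pos K
  have h0 := wordMap_split_sub r k t c a b y y'
  have h1 := mul_nonneg (pow_pos h.pos (wordWeight k (c ++ [a]))).le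
    (sub_nonneg.2 (h.wordMap_mem_Icc y (x := 1) (by simp)).2)
  have h2 := mul_nonneg (pow_pos h.pos (wordWeight k c)).le (sub_nonneg.2 (h.ordered a b hab))
  have h3 := mul_nonneg (pow_pos h.pos (wordWeight k (c ++ [b]))).le
    (h.wordMap_mem_Icc y' (x := 0) (by simp)).1
  have hsmall : min δ (r ^ (2 * M)) * r ^ K ≤ r ^ (2 * M) * r ^ K :=
    mul_le_mul_of_nonneg_right (min_le_right _ _) hrK.le
  have hwt := hw.wordWeight_le hM
  have hwt' := hw'.wordWeight_le hM
  rcases hδ' a b hab with heq | hgap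
  · rcases h.eq_replicate_top_or_le hM y with hy | hy
    · rcases h.eq_replicate_bot_or_le hM y' with hy' | hy'
      · exact Or.inl ⟨heq, hy, hy'⟩
      · right
        have h4 := mul_le_mul_of_nonneg_left hy' (pow_pos h.pos (wordWeight k (c ++ [b]))).le
        rw [← pow_add] at h4
        have h5 : r ^ (2 * M + K) ≤ r ^ (wordWeight k (c ++ [b]) + (wordWeight k y' + M)) :=
          pow_le_pow_of_le_one h.pos.le h.lt_one.le (by simp at hwt' ⊢; omega)
        rw [pow_add] at h5
        linarith
    · right
      have h4 := mul_le_mul_of_nonneg_left hy (pow_pos h.pos (wordWeight k (c ++ [a]))).le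
      rw [← pow_add] at h4
      have h5 : r ^ (2 * M + K) ≤ r ^ (wordWeight k (c ++ [a]) + (wordWeight k y + M)) :=
        pow_le_pow_of_le_one h.pos.le h.lt_one.le (by simp at hwt ⊢; omega)
      rw [pow_add] at h5
      linarith
  · right
    have hc := hw.2 c (a :: y) rfl (by simp)
    have h4 : min δ (r ^ (2 * M)) * r ^ K ≤ δ * r ^ wordWeight k c :=
      mul_le_mul (min_le_left _ _) (pow_le_pow_of_le_one h.pos.le h.lt_one.le hc.le) hrK.le hδ.le
    have h5 := mul_le_mul_of_nonneg_left hgap (pow_pos h.pos (wordWeight k c)).le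
    linarith

theorem touch_of_split (h : IsArrangement r k t) (c : List ι) {a b : ι} (hab : r ^ k a + t a = t b)
    (l l' : ℕ) : Touch r k t (c ++ a :: List.replicate l ⊤) (c ++ b :: List.replicate l' ⊥) := by
  simp [Touch, h.wordMap_replicate_top, h.wordMap_replicate_bot, affineFamily, hab]

theorem not_touch_of_lt (h : IsArrangement r k t) (c : List ι) {a b : ι} (hab : a < b)
    (y y' : List ι) : ¬ Touch r k t (c ++ b :: y') (c ++ a :: y) := by
  intro ht
  have h1 := h.split_le c hab y y'
  have h2 := h.wordMap_zero_lt_one (c ++ a :: y)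
  have h3 := h.wordMap_zero_lt_one (c ++ b :: y')
  rw [Touch] at ht
  linarith

theorem not_touch_self (h : IsArrangement r k t) (w : List ι) : ¬ Touch r k t w w :=
  fun ht => (h.wordMap_zero_lt_one w).ne' ht

theorem exists_split_of_touch [Finite ι] (h : IsArrangement r k t) {K : ℕ} {w w' : List ι}
    (hw : IsCut k K w) (hw' : IsCut k K w') (ht : Touch r k t w w') :
    ∃ c a b l l', a < b ∧ r ^ k a + t a = t b ∧ w = c ++ a :: List.replicate l ⊤ ∧
      w' = c ++ b :: List.replicate l' ⊥ := by
  have hne : w ≠ w' := fun he => h.not_touch_self w (by rwa [← he] at ht)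
  obtain ⟨c, a, b, y, y', hab, rfl, rfl⟩ := hw.exists_split hw' hne
  rcases lt_or_gt_of_ne hab with hlt | hlt
  · obtain ⟨η, hη, hgap⟩ := h.exists_split_gap
    rcases hgap K c a b y y' hlt hw hw' with ⟨h1, ⟨l, rfl⟩, ⟨l', rfl⟩⟩ | h1
    · exact ⟨c, a, b, l, l', hlt, h1, rfl, rfl⟩
    · have := mul_pos hη (pow_pos h.pos K)
      rw [Touch] at ht
      linarith
  · exact absurd ht (h.not_touch_of_lt c hlt _ _)

/-- Two intervals with the same left end overlap, whereas distinct cut words have nondegenerate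
intervals without common interior. -/
theorem touch_right_unique (h : IsArrangement r k t) {K : ℕ} {u v v' : List ι}
    (hv : IsCut k K v) (hv' : IsCut k K v') (h1 : Touch r k t u v) (h2 : Touch r k t u v') :
    v = v' := by
  by_contra hne
  obtain ⟨c, a, b, y, y', hab, rfl, rfl⟩ := hv.exists_split hv' hne
  have h3 := h.wordMap_zero_lt_one (c ++ a :: y)
  have h4 := h.wordMap_zero_lt_one (c ++ b :: y')
  rw [Touch] at h1 h2
  rcases lt_or_gt_of_ne hab with hlt | hlt
  · have := h.split_le c hlt y y'
    linarith
  · have := h.split_le c hlt y' y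
    linarith

theorem touch_left_unique (h : IsArrangement r k t) {K : ℕ} {u u' v : List ι}
    (hu : IsCut k K u) (hu' : IsCut k K u') (h1 : Touch r k t u v) (h2 : Touch r k t u' v) :
    u = u' := by
  by_contra hne
  obtain ⟨c, a, b, y, y', hab, rfl, rfl⟩ := hu.exists_split hu' hne
  have h3 := h.wordMap_zero_lt_one (c ++ a :: y)
  have h4 := h.wordMap_zero_lt_one (c ++ b :: y')
  rw [Touch] at h1 h2
  rcases lt_or_gt_of_ne hab with hlt | hlt
  · have := h.split_le c hlt y y'
    linarith
  · have := h.split_le c hlt y' y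
    linarith

/-- Two pieces at scale `r ^ K` which come close are equal or touch. -/
theorem exists_near_imp_touch [Finite ι] (h : IsArrangement r k t) : ∃ η : ℝ, 0 < η ∧
    ∀ (K : ℕ) (w w' : List ι), IsCut k K w → IsCut k K w' →
      ∀ x ∈ wordMap (affineFamily r k t) w '' Set.Icc 0 1,
      ∀ x' ∈ wordMap (affineFamily r k t) w' '' Set.Icc 0 1, |x - x'| < η * r ^ K →
        w = w' ∨ Touch r k t w w' ∨ Touch r k t w' w := by
  obtain ⟨η, hη, hgap⟩ := h.exists_split_gap
  refine ⟨η, hη, ?_⟩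
  rintro K w w' hw hw' _ ⟨x, hx, rfl⟩ _ ⟨x', hx', rfl⟩ hlt
  by_cases hne : w = w'
  · exact Or.inl hne
  right
  obtain ⟨c, a, b, y, y', hab, rfl, rfl⟩ := hw.exists_split hw' hne
  rw [abs_lt] at hlt
  rcases lt_or_gt_of_ne hab with hab | hab
  · left
    rcases hgap K c a b y y' hab hw hw' with ⟨h1, ⟨l, rfl⟩, ⟨l', rfl⟩⟩ | h1
    · exact h.touch_of_split c h1 l l'
    · have h2 := h.wordMap_mono (c ++ a :: y) hx.2
      have h3 := h.wordMap_mono (c ++ b :: y') hx'.1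
      linarith
  · right
    rcases hgap K c b a y' y hab hw' hw with ⟨h1, ⟨l, rfl⟩, ⟨l', rfl⟩⟩ | h1
    · exact h.touch_of_split c h1 l l'
    · have h2 := h.wordMap_mono (c ++ a :: y) hx.1
      have h3 := h.wordMap_mono (c ++ b :: y') hx'.2
      linarith

section Attractor

variable {T : Set ℝ}

theorem subset_Icc (h : IsArrangement r k t) (hne : T.Nonempty) (hc : IsCompact T)
    (hT : ⋃ i, affineFamily r k t i '' T = T) : T ⊆ Set.Icc 0 1 := by
  obtain ⟨m, hm, hmin⟩ := hc.exists_isLeast hne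
  obtain ⟨p, hp, hmax⟩ := hc.exists_isGreatest hne
  have hlt : ∀ a, r ^ k a < 1 := fun a => pow_lt_one₀ h.pos.le h.lt_one (h.weight_pos a).ne'
  have h0 : 0 ≤ m := by
    obtain ⟨a, x, hx, hxm⟩ : ∃ a, ∃ x ∈ T, affineFamily r k t a x = m := by
      rw [← hT] at hm; simpa using hm
    have h1 := mul_le_mul_of_nonneg_left (hmin hx) (pow_pos h.pos (k a)).le
    have h2 := h.translation_nonneg a
    have h3 := hlt a
    simp only [affineFamily] at hxm
    nlinarith
  have h1 : p ≤ 1 := by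
    obtain ⟨a, x, hx, hxm⟩ : ∃ a, ∃ x ∈ T, affineFamily r k t a x = p := by
      rw [← hT] at hp; simpa using hp
    have h1 := mul_le_mul_of_nonneg_left (hmax hx) (pow_pos h.pos (k a)).le
    have h2 := h.right_end_le_one a
    have h3 := hlt a
    simp only [affineFamily] at hxm
    nlinarith
  exact fun x hx => ⟨h0.trans (hmin hx), (hmax hx).trans h1⟩

theorem zero_mem (h : IsArrangement r k t) (hne : T.Nonempty) (hc : IsCompact T)
    (hT : ⋃ i, affineFamily r k t i '' T = T) : (0 : ℝ) ∈ T := by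
  obtain ⟨m, hm, hmin⟩ := hc.exists_isLeast hne
  have h0 := (h.subset_Icc hne hc hT hm).1
  have h1 := hmin (wordMap_mem hT [⊥] hm)
  simp only [wordMap_cons, wordMap_nil, affineFamily, h.first, add_zero] at h1
  have h2 : r ^ k ⊥ < 1 := pow_lt_one₀ h.pos.le h.lt_one (h.weight_pos _).ne'
  have h3 : m = 0 := by nlinarith
  exact h3 ▸ hm

theorem one_mem (h : IsArrangement r k t) (hne : T.Nonempty) (hc : IsCompact T)
    (hT : ⋃ i, affineFamily r k t i '' T = T) : (1 : ℝ) ∈ T := by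
  obtain ⟨m, hm, hmax⟩ := hc.exists_isGreatest hne
  have h0 := (h.subset_Icc hne hc hT hm).2
  have h1 := hmax (wordMap_mem hT [⊤] hm)
  simp only [wordMap_cons, wordMap_nil, affineFamily] at h1
  have h2 : r ^ k ⊤ < 1 := pow_lt_one₀ h.pos.le h.lt_one (h.weight_pos _).ne'
  have h4 := h.last
  have h3 : m = 1 := by nlinarith
  exact h3 ▸ hm

end Attractor

end IsArrangement

end Arrangement

/-! ### Separation of the pieces of the dust-like set -/

section Dust

variable {ι : Type*} [Finite ι]

theorem IsSimilitude.continuous {r : ℝ} {f : ℝ → ℝ} (hr : 0 ≤ r) (hf : IsSimilitude r f) :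
    Continuous f :=
  (LipschitzWith.of_dist_le_mul (K := ⟨r, hr⟩) fun x y => (hf x y).le).continuous

/-- Points in different pieces of a dust-like set at scale `r ^ K` are at distance at least
`η * r ^ K`. -/
theorem exists_dust_separation {f : ι → ℝ → ℝ} {r : ℝ} {k : ι → ℕ} {D : Set ℝ} (hr : 0 < r)
    (hr1 : r < 1) (hf : ∀ a, IsSimilitude (r ^ k a) (f a)) (hc : IsCompact D)
    (hD : ⋃ i, f i '' D = D) (hdisj : ∀ i j, i ≠ j → Disjoint (f i '' D) (f j '' D)) :
    ∃ η : ℝ, 0 < η ∧ ∀ (K : ℕ) (w w' : List ι), IsCut k K w → IsCut k K w' →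
      ∀ x ∈ wordMap f w '' D, ∀ x' ∈ wordMap f w' '' D, |x - x'| < η * r ^ K → w = w' := by
  obtain ⟨η, hη, hsep⟩ : ∃ η : ℝ, 0 < η ∧ ∀ a b, a ≠ b → ∀ x ∈ f a '' D, ∀ y ∈ f b '' D,
      η ≤ |x - y| := by
    have hcomp : ∀ a, IsCompact (f a '' D) := fun a =>
      hc.image ((hf a).continuous (pow_pos hr _).le)
    have hev : ∀ p : ι × ι, ∃ δ : ℝ, 0 < δ ∧ (p.1 ≠ p.2 → ∀ x ∈ f p.1 '' D, ∀ y ∈ f p.2 '' D,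
        δ ≤ |x - y|) := by
      intro p
      by_cases hp : p.1 = p.2
      · exact ⟨1, one_pos, fun h => absurd hp h⟩
      · obtain ⟨δ, hδ, h⟩ := Metric.exists_pos_forall_lt_edist (hcomp p.1) (hcomp p.2).isClosed
          (hdisj _ _ hp)
        refine ⟨δ, hδ, fun _ x hx y hy => ?_⟩
        have h1 := h x hx y hy
        rw [edist_nndist, ENNReal.coe_lt_coe, ← NNReal.coe_lt_coe, coe_nndist, Real.dist_eq] at h1
        exact h1.le
    choose δ hδ0 hδ using hev
    rcases isEmpty_or_nonempty (ι × ι) with he | hne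
    · exact ⟨1, one_pos, fun a b => (he.false (a, b)).elim⟩
    · obtain ⟨p, hp⟩ := Finite.exists_min δ
      exact ⟨δ p, hδ0 p, fun a b hab x hx y hy => (hp (a, b)).trans (hδ (a, b) hab x hx y hy)⟩
  refine ⟨η, hη, ?_⟩
  rintro K w w' hw hw' _ ⟨x, hx, rfl⟩ _ ⟨x', hx', rfl⟩ hlt
  by_contra hne
  obtain ⟨c, a, b, y, y', hab, rfl, rfl⟩ := hw.exists_split hw' hne
  have h1 := hsep a b hab _ ⟨_, wordMap_mem hD y hx, rfl⟩ _ ⟨_, wordMap_mem hD y' hx', rfl⟩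
  simp only [wordMap_append, wordMap_cons] at hlt
  rw [dist_wordMap hf] at hlt
  -- The common prefix `c` is proper, so its weight is below `K` and it shrinks the first-level
  -- separation by a factor no smaller than `r ^ K`.
  have h2 : r ^ K ≤ r ^ wordWeight k c :=
    pow_le_pow_of_le_one hr.le hr1.le (hw.2 c (a :: y) rfl (by simp)).le
  have h3 := mul_le_mul h2 h1 hη.le (pow_pos hr _).le
  linarith

end Dust

/-! ### Exchanging parts of touching pieces -/

section Exchange

variable {ι : Type*} [LinearOrder ι] [BoundedOrder ι]

/-- The choices needed to exchange, for touching words `u` and `v` of comparable size, a part of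
the piece of `v` close to the touching point with a part of the same size of the piece of `u` which
is separated from the rest. The letters up to `left` are separated by a gap from the letters from
`right` on. -/
structure ExchangeData (r : ℝ) (k : ι → ℕ) (t : ι → ℝ) where
  left : ι
  right : ι
  lt_right_iff : ∀ a, a < right ↔ a ≤ left
  gap : ∀ a b, a ≤ left → right ≤ b → r ^ k a + t a < t b
  -- The word is used framed by `right`. The first `right` tells the two sides of an exchange apart,
  -- since the other side continues with `⊥`; the last one puts a gap to the left of the exchanged
  -- part.
  inner : List ι → List ι → List ι
  reps : List ι → List ι → ℕ
  step : ℕ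
  maxWeight : ℕ
  weight_le : ∀ a, k a ≤ maxWeight
  step_pos : 0 < step
  reps_pos : ∀ u v, 0 < reps u v
  weight_eq : ∀ K u v, IsCut k K u → IsCut k K v → Touch r k t u v →
    wordWeight k u + wordWeight k (right :: inner u v ++ [right]) =
      wordWeight k v + reps u v * k ⊥
  lt_step : ∀ K u v, IsCut k K u → IsCut k K v → Touch r k t u v →
    maxWeight + reps u v * k ⊥ < step

namespace ExchangeData

variable {r : ℝ} {k : ι → ℕ} {t : ι → ℝ} (X : ExchangeData r k t)

theorem left_lt_right : X.left < X.right := (X.lt_right_iff _).2 le_rfl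

theorem left_lt_top : X.left < ⊤ := X.left_lt_right.trans_le le_top

theorem bot_lt_right : ⊥ < X.right := bot_le.trans_lt X.left_lt_right

/-- The words exchanged at level `K`. -/
def SwapPair (K : ℕ) (w w' : List ι) : Prop :=
  ∃ u v a z, IsCut k K u ∧ IsCut k K v ∧ Touch r k t u v ∧ a ≤ X.left ∧
    w = u ++ (X.right :: X.inner u v ++ [X.right] ++ a :: z) ∧
    w' = v ++ (List.replicate (X.reps u v) ⊥ ++ a :: z)

/-- The involution of the words which performs all exchanges of level `K`, as a relation. -/
def SwapRel (K : ℕ) (w w' : List ι) : Prop :=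
  X.SwapPair K w w' ∨ X.SwapPair K w' w ∨
    (w = w' ∧ ∀ x, ¬ X.SwapPair K w x ∧ ¬ X.SwapPair K x w)

variable {X}

theorem SwapRel.symm {K : ℕ} {w w' : List ι} (h : X.SwapRel K w w') : X.SwapRel K w' w := by
  rcases h with h | h | ⟨rfl, h⟩
  · exact Or.inr (Or.inl h)
  · exact Or.inl h
  · exact Or.inr (Or.inr ⟨rfl, h⟩)

theorem exists_swapRel (K : ℕ) (w : List ι) : ∃ w', X.SwapRel K w w' := by
  by_cases h1 : ∃ x, X.SwapPair K w x
  · exact h1.imp fun _ h => Or.inl h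
  by_cases h2 : ∃ x, X.SwapPair K x w
  · exact h2.imp fun _ h => Or.inr (Or.inl h)
  push Not at h1 h2
  exact ⟨w, Or.inr (Or.inr ⟨rfl, fun x => ⟨h1 x, h2 x⟩⟩)⟩

theorem SwapPair.right_unique (h : IsArrangement r k t) {K : ℕ} {w x x' : List ι}
    (h1 : X.SwapPair K w x) (h2 : X.SwapPair K w x') : x = x' := by
  obtain ⟨u, v, a, z, hu, hv, ht, -, rfl, rfl⟩ := h1
  obtain ⟨u', v', a', z', hu', hv', ht', -, he, rfl⟩ := h2
  obtain ⟨rfl, he⟩ := hu.eq_of_append_eq hu' he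
  obtain rfl := h.touch_right_unique hv hv' ht ht'
  rw [List.append_cancel_left he]

theorem SwapPair.left_unique (h : IsArrangement r k t) {K : ℕ} {w x x' : List ι}
    (h1 : X.SwapPair K x w) (h2 : X.SwapPair K x' w) : x = x' := by
  obtain ⟨u, v, a, z, hu, hv, ht, -, rfl, rfl⟩ := h1
  obtain ⟨u', v', a', z', hu', hv', ht', -, rfl, he⟩ := h2
  obtain ⟨rfl, he⟩ := hv.eq_of_append_eq hv' he
  obtain rfl := h.touch_left_unique hu hu' ht ht'
  rw [List.append_cancel_left he]

theorem SwapPair.not_swapPair {K : ℕ} {w x x' : List ι}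
    (h1 : X.SwapPair K w x) : ¬ X.SwapPair K x' w := by
  intro h2
  obtain ⟨u, v, a, z, hu, hv, ht, -, rfl, rfl⟩ := h1
  obtain ⟨u', v', a', z', hu', hv', ht', -, rfl, he⟩ := h2
  obtain ⟨rfl, he⟩ := hu.eq_of_append_eq hv' he
  obtain ⟨m, hm⟩ := Nat.exists_eq_succ_of_ne_zero (X.reps_pos u' u).ne'
  rw [hm, List.replicate_succ] at he
  simp only [List.cons_append, List.cons.injEq] at he
  exact X.bot_lt_right.ne' he.1

theorem SwapRel.right_unique (h : IsArrangement r k t) {K : ℕ} {w x x' : List ι}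
    (h1 : X.SwapRel K w x) (h2 : X.SwapRel K w x') : x = x' := by
  rcases h1 with h1 | h1 | ⟨rfl, h1⟩ <;> rcases h2 with h2 | h2 | ⟨rfl, h2⟩
  · exact h1.right_unique h h2
  · exact absurd h2 h1.not_swapPair
  · exact absurd h1 (h2 _).1
  · exact absurd h1 h2.not_swapPair
  · exact h1.left_unique h h2
  · exact absurd h1 (h2 _).2
  · exact absurd h2 (h1 _).1
  · exact absurd h2 (h1 _).2
  · rfl

theorem SwapPair.wordWeight_eq {K : ℕ} {w x : List ι} (h : X.SwapPair K w x) :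
    wordWeight k w = wordWeight k x := by
  obtain ⟨u, v, a, z, hu, hv, ht, -, rfl, rfl⟩ := h
  have := X.weight_eq K u v hu hv ht
  simp at this ⊢
  omega

theorem SwapRel.wordWeight_eq {K : ℕ} {w x : List ι} (h : X.SwapRel K w x) :
    wordWeight k w = wordWeight k x := by
  rcases h with h | h | ⟨rfl, -⟩
  · exact h.wordWeight_eq
  · exact h.wordWeight_eq.symm
  · rfl

theorem SwapRel.isCut {K K' : ℕ} {w x : List ι} (h : X.SwapRel K w x) (hw : IsCut k K' w) :
    IsCut k K' x := by
  rcases h with h | h | ⟨rfl, -⟩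
  · obtain ⟨u, v, a, z, hu, hv, ht, -, rfl, rfl⟩ := h
    have := X.weight_eq K u v hu hv ht
    rw [← List.append_assoc] at hw ⊢
    exact hw.replace_prefix (by simp at this ⊢; omega) (by simp)
  · obtain ⟨u, v, a, z, hu, hv, ht, -, rfl, rfl⟩ := h
    have := X.weight_eq K u v hu hv ht
    rw [← List.append_assoc] at hw ⊢
    exact hw.replace_prefix (by simp at this ⊢; omega) (by simp)
  · exact hw

/-- Left parts are closed under passing to a touching right neighbour. The letter `a'` is not in the
tail of `⊤`s, as `left < ⊤`; if it is `a` itself, the gap prevents `b` from crossing to `right`. -/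
theorem exists_right_of_left (X : ExchangeData r k t) {c q z : List ι} {a b a' : ι} {l : ℕ}
    (y : List ι)
    (hab : r ^ k a + t a = t b) (ha' : a' ≤ X.left)
    (he : c ++ a :: List.replicate l ⊤ = q ++ a' :: z) :
    ∃ a'' z', a'' ≤ X.left ∧ c ++ b :: y = q ++ a'' :: z' := by
  have hb : a ≤ X.left → b ≤ X.left := fun ha => by
    by_contra hb
    exact (X.gap a b ha (not_lt.1 fun hlt => hb ((X.lt_right_iff b).1 hlt))).ne hab
  rcases List.append_eq_append_iff.1 he with ⟨s, rfl, h2⟩ | ⟨s, rfl, h2⟩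
  · rcases s with _ | ⟨d, s⟩
    · simp at h2
      exact ⟨b, y, hb (h2.1 ▸ ha'), by simp⟩
    · simp at h2
      have : a' ∈ List.replicate l ⊤ := by rw [h2.2]; simp
      exact absurd ((List.eq_of_mem_replicate this).symm.le.trans ha') (not_le.2 X.left_lt_top)
  · rcases s with _ | ⟨d, s⟩
    · simp at h2
      exact ⟨b, y, hb (h2.1 ▸ ha'), by simp⟩
    · simp at h2
      exact ⟨d, s ++ b :: y, h2.1 ▸ ha', by simp⟩

/-- The left neighbour can leave the left part of `q` only at the left end of the piece of `q`,
which is the second alternative. -/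
theorem exists_left_of_right (X : ExchangeData r k t) {c q z : List ι} {a b a' : ι} {l : ℕ}
    (y : List ι)
    (hab : a < b) (ha' : a' ≤ X.left)
    (he : c ++ b :: List.replicate l ⊥ = q ++ a' :: z) :
    (∃ a'' z', a'' ≤ X.left ∧ c ++ a :: y = q ++ a'' :: z') ∨
      ∃ i, q = c ++ b :: List.replicate i ⊥ := by
  rcases List.append_eq_append_iff.1 he with ⟨s, rfl, h2⟩ | ⟨s, rfl, h2⟩
  · rcases s with _ | ⟨d, s⟩
    · simp at h2
      exact Or.inl ⟨a, y, hab.le.trans (h2.1 ▸ ha'), by simp⟩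
    · simp at h2
      obtain ⟨rfl, h2⟩ := h2
      exact Or.inr ⟨s.length, by rw [← (List.append_eq_replicate_iff.1 h2.symm).2.1]⟩
  · rcases s with _ | ⟨d, s⟩
    · simp at h2
      exact Or.inl ⟨a, y, hab.le.trans (h2.1 ▸ ha'), by simp⟩
    · simp at h2
      exact Or.inl ⟨d, s ++ a :: y, h2.1 ▸ ha', by simp⟩

/-- After the exchanges, touching words of the next level have a common ancestor. -/
theorem exists_common_prefix [Finite ι] (h : IsArrangement r k t) {K : ℕ} {w w' x x' : List ι}
    (hw : IsCut k (K + X.step) w) (hw' : IsCut k (K + X.step) w') (ht : Touch r k t w w')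
    (hx : X.SwapRel K w x) (hx' : X.SwapRel K w' x') :
    ∃ u, IsCut k K u ∧ u <+: x ∧ u <+: x' := by
  obtain ⟨c, a, b, l, l', hlt, hab, rfl, rfl⟩ := h.exists_split_of_touch hw hw' ht
  obtain ⟨u, y, huy, hu⟩ := exists_isCut_prefix (k := k) (K := K) _ (le_self_add.trans hw.1)
  obtain ⟨u', y', huy', hu'⟩ := exists_isCut_prefix (k := k) (K := K) _ (le_self_add.trans hw'.1)
  by_cases hne : u = u'
  · subst hne
    -- Contact inside one level-`K` piece: the two words are moved together or not at all.
    rcases hx with hx | hx | ⟨rfl, hno⟩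
    · have hx0 := hx
      obtain ⟨u₁, v, a₁, z, hu₁, hv, htv, ha₁, he, rfl⟩ := hx
      obtain ⟨a₂, z₂, ha₂, he₂⟩ := X.exists_right_of_left (y := List.replicate l' ⊥) hab ha₁
        (he.trans (List.append_assoc _ _ _).symm)
      rw [List.append_assoc] at he₂
      obtain rfl := hx'.right_unique h (Or.inl ⟨u₁, v, a₂, z₂, hu₁, hv, htv, ha₂, he₂, rfl⟩)
      exact ⟨v, hv, List.prefix_append _ _, List.prefix_append _ _⟩
    · obtain ⟨u₁, v, a₁, z, hu₁, hv, htv, ha₁, rfl, he⟩ := hx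
      obtain ⟨a₂, z₂, ha₂, he₂⟩ := X.exists_right_of_left (y := List.replicate l' ⊥) hab ha₁
        (he.trans (List.append_assoc _ _ _).symm)
      rw [List.append_assoc] at he₂
      obtain rfl := hx'.right_unique h
        (Or.inr (Or.inl ⟨u₁, v, a₂, z₂, hu₁, hv, htv, ha₂, rfl, he₂⟩))
      exact ⟨u₁, hu₁, List.prefix_append _ _, List.prefix_append _ _⟩
    · rcases hx' with hx' | hx' | ⟨rfl, -⟩
      · exfalso
        obtain ⟨u₁, v, a₁, z, hu₁, hv, htv, ha₁, he, rfl⟩ := hx'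
        rcases X.exists_left_of_right (y := List.replicate l ⊤) hlt ha₁
          (he.trans (List.append_assoc _ _ _).symm) with ⟨a₂, z₂, ha₂, he₂⟩ | ⟨i, hi⟩
        · rw [List.append_assoc] at he₂
          exact (hno _).1 ⟨u₁, v, a₂, z₂, hu₁, hv, htv, ha₂, he₂, rfl⟩
        -- Here `q` ends in `right`, so either `b = right`, contradicting the gap to its left, or
        -- `right = ⊥`.
        · rw [← List.append_assoc] at hi
          rcases i with _ | i
          · obtain rfl : X.right = b := by simpa using (List.append_inj' hi rfl).2
            exact (X.gap a _ ((X.lt_right_iff a).1 hlt) le_rfl).ne hab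
          · rw [List.replicate_succ', ← List.cons_append, ← List.append_assoc] at hi
            exact X.bot_lt_right.ne' (by simpa using (List.append_inj' hi rfl).2)
      · exfalso
        obtain ⟨u₁, v, a₁, z, hu₁, hv, htv, ha₁, rfl, he⟩ := hx'
        obtain ⟨rfl, -⟩ := hu.eq_of_append_eq hv (huy'.symm.trans he)
        rcases X.exists_left_of_right (y := List.replicate l ⊤) hlt ha₁
          (he.trans (List.append_assoc _ _ _).symm) with ⟨a₂, z₂, ha₂, he₂⟩ | ⟨i, hi⟩
        · rw [List.append_assoc] at he₂
          exact (hno _).2 ⟨u₁, u, a₂, z₂, hu₁, hv, htv, ha₂, rfl, he₂⟩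
        -- The words split only after `u`, so the exceptional case puts `b` among the letters `⊥`,
        -- against `a < b`.
        · obtain ⟨c', rfl⟩ : ∃ c', c = u ++ c' := by
            rcases List.append_eq_append_iff.1 huy' with ⟨s, rfl, h2⟩ | ⟨s, rfl, h2⟩
            · rcases s with _ | ⟨d, s⟩
              · exact ⟨[], by simp⟩
              · exfalso
                simp at huy h2
                exact hlt.ne (huy.1.trans h2.1.symm)
            · exact ⟨s, rfl⟩
          rw [List.append_assoc] at hi
          have hi := List.append_cancel_left hi
          have hb : b ∈ List.replicate (X.reps u₁ u) (⊥ : ι) := by rw [hi]; simp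
          exact not_lt_bot (List.eq_of_mem_replicate hb ▸ hlt)
      · exact ⟨u, hu, huy ▸ List.prefix_append _ _, huy' ▸ List.prefix_append _ _⟩
  -- Contact between two level-`K` pieces: `u` and `u'` themselves touch, and the remaining tails
  -- consist of `⊤`s and `⊥`s respectively.
  · obtain ⟨p, p', rfl, rfl⟩ : ∃ p p', u = c ++ a :: List.replicate p ⊤ ∧
        y = List.replicate p' ⊤ := by
      rcases List.append_eq_append_iff.1 huy with ⟨s, rfl, h2⟩ | ⟨s, rfl, h2⟩
      · rcases s with _ | ⟨d, s⟩
        · exact absurd (hu.eq_of_append_eq hu' (show c ++ [] ++ (b :: List.replicate l' ⊥) = u' ++ y' by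
            rw [List.append_nil]; exact huy')).1 hne
        · simp at h2
          obtain ⟨rfl, h2⟩ := h2
          have h3 := (List.append_eq_replicate_iff.1 h2.symm).2
          exact ⟨_, _, by rw [← h3.1], h3.2⟩
      · exact absurd (hu.eq_of_append_eq hu' ((List.append_assoc _ _ _).symm.trans huy')).1 hne
    obtain ⟨i, i', rfl, rfl⟩ : ∃ p p', u' = c ++ b :: List.replicate p ⊥ ∧
        y' = List.replicate p' ⊥ := by
      rcases List.append_eq_append_iff.1 huy' with ⟨s, rfl, h2⟩ | ⟨s, rfl, h2⟩
      · rcases s with _ | ⟨d, s⟩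
        · exact absurd (hu.eq_of_append_eq hu' (show c ++ a :: List.replicate p ⊤ ++ List.replicate p' ⊤ =
            c ++ [] ++ (a :: List.replicate l ⊤) by
            rw [List.append_nil]; exact huy.symm)).1 hne
        · simp at h2
          obtain ⟨rfl, h2⟩ := h2
          have h3 := (List.append_eq_replicate_iff.1 h2.symm).2
          exact ⟨_, _, by rw [← h3.1], h3.2⟩
      · exact absurd (hu.eq_of_append_eq hu' (huy.symm.trans (List.append_assoc _ _ _))).1 hne
    have htu := h.touch_of_split c hab p i
    rw [huy] at hx hw
    rw [huy'] at hx' hw'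
    set u := c ++ a :: List.replicate p ⊤
    set u' := c ++ b :: List.replicate i ⊥
    -- The bound `lt_step` makes the tail of `⊥`s long enough for `w'` to lie in the exchanged part,
    -- so `w'` moves into `u`. The tail of `⊤`s keeps `w` fixed.
    have hlen : X.reps u u' < i' := by
      have h1 := X.lt_step K u u' hu hu' htu
      have h2 := hu'.wordWeight_le X.weight_le
      have h3 := hw'.1
      rw [wordWeight_append, wordWeight_replicate] at h3
      have h4 : X.reps u u' * k ⊥ < i' * k ⊥ := by omega
      exact lt_of_mul_lt_mul_right h4 (Nat.zero_le _)
    obtain ⟨j, rfl⟩ := Nat.exists_eq_add_of_lt hlen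
    rw [add_assoc, List.replicate_add, List.replicate_succ] at hx'
    obtain rfl := hx'.right_unique h
      (Or.inr (Or.inl ⟨u, u', ⊥, _, hu, hu', htu, bot_le, rfl, rfl⟩))
    have htop : ∀ a' z q, List.replicate p' ⊤ = q ++ a' :: z → ¬ a' ≤ X.left := by
      intro a' z q he hle
      have : a' ∈ List.replicate p' (⊤ : ι) := by rw [he]; simp
      exact absurd ((List.eq_of_mem_replicate this).symm.le.trans hle) (not_le.2 X.left_lt_top)
    rcases hx with hx | hx | ⟨rfl, -⟩
    · exfalso
      obtain ⟨u₁, v, a₁, z, hu₁, hv, htv, ha₁, he, rfl⟩ := hx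
      exact htop _ _ _ (hu.eq_of_append_eq hu₁ he).2 ha₁
    · exfalso
      obtain ⟨u₁, v, a₁, z, hu₁, hv, htv, ha₁, rfl, he⟩ := hx
      exact htop _ _ _ (hu.eq_of_append_eq hv he).2 ha₁
    · exact ⟨u, hu, List.prefix_append _ _, List.prefix_append _ _⟩

/-! ### Matchings of the pieces, level by level -/

variable (X)

/-- The matching of the pieces of the touching set with the pieces of the dust-like set at level
`κ`, obtained by performing the exchanges of all levels below `κ`. -/
def Matching : ℕ → List ι → List ι → Prop
  | 0, w, v => w = [] ∧ v = []
  | κ + 1, w, v => IsCut k (κ * X.step + X.step) w ∧ ∃ u y v₀, X.SwapRel (κ * X.step) w (u ++ y) ∧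
      IsCut k (κ * X.step) u ∧ Matching κ u v₀ ∧ v = v₀ ++ y

variable {X}

theorem Matching.isCut {κ : ℕ} {w v : List ι} (h : X.Matching κ w v) :
    IsCut k (κ * X.step) w ∧ IsCut k (κ * X.step) v ∧ wordWeight k w = wordWeight k v := by
  induction κ generalizing w v with
  | zero =>
    obtain ⟨rfl, rfl⟩ := h
    simp [isCut_zero_iff]
  | succ κ ih =>
    obtain ⟨hw, u, y, v₀, hs, hu, hm, rfl⟩ := h
    obtain ⟨-, hv₀, hwt⟩ := ih hm
    rw [Nat.succ_mul]
    refine ⟨hw, ?_, by rw [hs.wordWeight_eq]; simp [hwt]⟩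
    have huy := hs.isCut hw
    rcases eq_or_ne y [] with rfl | hy
    · rw [List.append_nil] at huy ⊢
      exact ⟨hwt ▸ huy.1, fun p s hps hs => (hv₀.2 p s hps hs).trans_le le_self_add⟩
    · exact huy.replace_prefix hwt hy

theorem exists_matching_left {κ : ℕ} {w : List ι} (hw : IsCut k (κ * X.step) w) :
    ∃ v, X.Matching κ w v := by
  induction κ generalizing w with
  | zero => exact ⟨[], isCut_zero_iff.1 (by simpa using hw), rfl⟩
  | succ κ ih =>
    rw [Nat.succ_mul] at hw
    obtain ⟨x, hx⟩ := exists_swapRel (X := X) (κ * X.step) w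
    obtain ⟨u, y, rfl, hu⟩ := exists_isCut_prefix (k := k) x (le_self_add.trans (hx.isCut hw).1)
    obtain ⟨v, hv⟩ := ih hu
    exact ⟨v ++ y, hw, u, y, v, hx, hu, hv, rfl⟩

theorem exists_matching_right {κ : ℕ} {v : List ι} (hv : IsCut k (κ * X.step) v) :
    ∃ w, X.Matching κ w v := by
  induction κ generalizing v with
  | zero => exact ⟨[], rfl, isCut_zero_iff.1 (by simpa using hv)⟩
  | succ κ ih =>
    rw [Nat.succ_mul] at hv
    obtain ⟨v₀, y, rfl, hv₀⟩ := exists_isCut_prefix (k := k) v (le_self_add.trans hv.1)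
    obtain ⟨u, hu⟩ := ih hv₀
    obtain ⟨hu', -, hwt⟩ := hu.isCut
    obtain ⟨w, hw⟩ := exists_swapRel (X := X) (κ * X.step) (u ++ y)
    refine ⟨w, hw.isCut ?_, u, y, v₀, hw.symm, hu', hu, rfl⟩
    rcases eq_or_ne y [] with rfl | hy
    · rw [List.append_nil] at hv ⊢
      exact ⟨hwt ▸ hv.1, fun p s hps hs => (hu'.2 p s hps hs).trans_le le_self_add⟩
    · exact hv.replace_prefix hwt.symm hy

theorem Matching.left_unique (h : IsArrangement r k t) {κ : ℕ} {w w' v : List ι}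
    (h1 : X.Matching κ w v) (h2 : X.Matching κ w' v) : w = w' := by
  induction κ generalizing w w' v with
  | zero => rw [h1.1, h2.1]
  | succ κ ih =>
    obtain ⟨-, u, y, v₀, hs, hu, hm, rfl⟩ := h1
    obtain ⟨-, u', y', v₀', hs', hu', hm', he⟩ := h2
    obtain ⟨rfl, rfl⟩ := hm.isCut.2.1.eq_of_append_eq hm'.isCut.2.1 he
    obtain rfl := ih hm hm'
    exact hs.symm.right_unique h hs'.symm

theorem Matching.right_unique (h : IsArrangement r k t) {κ : ℕ} {w v v' : List ι}
    (h1 : X.Matching κ w v) (h2 : X.Matching κ w v') : v = v' := by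
  induction κ generalizing w v v' with
  | zero => rw [h1.2, h2.2]
  | succ κ ih =>
    obtain ⟨-, u, y, v₀, hs, hu, hm, rfl⟩ := h1
    obtain ⟨-, u', y', v₀', hs', hu', hm', rfl⟩ := h2
    obtain ⟨rfl, rfl⟩ := hu.eq_of_append_eq hu' (hs.right_unique h hs')
    rw [ih hm hm']

theorem Matching.exists_common_prefix [Finite ι] (h : IsArrangement r k t) {κ : ℕ}
    {w w' v v' : List ι} (hm : X.Matching (κ + 1) w v) (hm' : X.Matching (κ + 1) w' v')
    (ht : Touch r k t w w') : ∃ v₀, IsCut k (κ * X.step) v₀ ∧ v₀ <+: v ∧ v₀ <+: v' := by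
  obtain ⟨hw, u, y, v₀, hs, hu, hm, rfl⟩ := hm
  obtain ⟨hw', u', y', v₀', hs', hu', hm', rfl⟩ := hm'
  obtain ⟨c, hc, ⟨s, hcs⟩, ⟨s', hcs'⟩⟩ := ExchangeData.exists_common_prefix h hw hw' ht hs hs'
  obtain rfl := (hc.eq_of_append_eq hu hcs).1
  obtain rfl := (hc.eq_of_append_eq hu' hcs').1
  obtain rfl := hm.right_unique h hm'
  exact ⟨v₀, hm.isCut.2.1, List.prefix_append _ _, List.prefix_append _ _⟩

/-- An exchange at level `κ` either fixes a word or replaces its level-`κ` ancestor by a touching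
one. This bounds the displacement between successive matchings. -/
theorem Matching.exists_parent {κ : ℕ} {w v : List ι} (hm : X.Matching (κ + 1) w v) :
    ∃ u u' v₀ y y', w = u ++ y ∧ v = v₀ ++ y' ∧ IsCut k (κ * X.step) u ∧ X.Matching κ u' v₀ ∧
      (u = u' ∨ Touch r k t u u' ∨ Touch r k t u' u) := by
  obtain ⟨hw, u', y', v₀, hs, hu', hm, rfl⟩ := hm
  rcases hs with hs | hs | ⟨rfl, -⟩
  · obtain ⟨u, u₁, a, z, hu, hu₁, ht, -, rfl, he⟩ := hs
    obtain rfl := (hu'.eq_of_append_eq hu₁ he).1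
    exact ⟨u, u', v₀, _, y', rfl, rfl, hu, hm, Or.inr (Or.inl ht)⟩
  · obtain ⟨u₁, u, a, z, hu₁, hu, ht, -, he, rfl⟩ := hs
    obtain rfl := (hu'.eq_of_append_eq hu₁ he).1
    exact ⟨u, u', v₀, _, y', rfl, rfl, hu, hm, Or.inr (Or.inr ht)⟩
  · exact ⟨u', u', v₀, y', y', rfl, rfl, hu', hm, Or.inl rfl⟩

end ExchangeData

end Exchange

/-! ### Metric estimates and construction of the exchange data -/

section Main

variable {ι : Type*} [LinearOrder ι] [BoundedOrder ι] [Finite ι]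

theorem dist_le_of_mem_image_wordMap {ι : Type*} {f : ι → ℝ → ℝ} {r : ℝ} {k : ι → ℕ} {E : Set ℝ}
    {d : ℝ} {K : ℕ} (hr : 0 < r) (hr1 : r < 1) (hf : ∀ a, IsSimilitude (r ^ k a) (f a))
    (hd : ∀ x ∈ E, ∀ y ∈ E, |x - y| ≤ d)
    {w : List ι} (hw : IsCut k K w) {x y : ℝ} (hx : x ∈ wordMap f w '' E)
    (hy : y ∈ wordMap f w '' E) : |x - y| ≤ d * r ^ K := by
  obtain ⟨x, hx, rfl⟩ := hx
  obtain ⟨y, hy, rfl⟩ := hy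
  rw [dist_wordMap hf, mul_comm]
  exact mul_le_mul (hd x hx y hy) (pow_le_pow_of_le_one hr.le hr1.le hw.1) (pow_pos hr _).le
    ((abs_nonneg _).trans (hd x hx y hy))

/-- A dust-like set and a touching arrangement whose ratios are the same powers of one number are
Lipschitz equivalent as soon as the necessary exchanges are possible. -/
theorem ExchangeData.lipschitzEquivalent {r : ℝ} {k : ι → ℕ} {t : ι → ℝ} (X : ExchangeData r k t)
    (h : IsArrangement r k t) {f : ι → ℝ → ℝ} (hf : ∀ a, IsSimilitude (r ^ k a) (f a))
    {D T : Set ℝ} (hDne : D.Nonempty) (hDc : IsCompact D) (hD : ⋃ i, f i '' D = D)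
    (hdisj : ∀ i j, i ≠ j → Disjoint (f i '' D) (f j '' D))
    (hTne : T.Nonempty) (hTc : IsCompact T) (hT : ⋃ i, affineFamily r k t i '' T = T) :
    LipschitzEquivalent D T := by
  obtain ⟨η₁, hη₁, hsep⟩ := exists_dust_separation h.pos h.lt_one hf hDc hD hdisj
  obtain ⟨η₂, hη₂, htouch⟩ := h.exists_near_imp_touch
  have hTI := h.subset_Icc hTne hTc hT
  have hT0 := h.zero_mem hTne hTc hT
  have hT1 := h.one_mem hTne hTc hT
  have hfT := isSimilitude_affineFamily h.pos k t
  obtain ⟨d, hd0, hd⟩ : ∃ d : ℝ, 0 < d ∧ ∀ x ∈ D, ∀ y ∈ D, |x - y| ≤ d := by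
    obtain ⟨d, hd⟩ := hDc.isBounded.exists_norm_le
    have h0 := (norm_nonneg _).trans (hd _ hDne.some_mem)
    refine ⟨2 * d + 1, by linarith, fun x hx y hy => ?_⟩
    have h1 := hd x hx
    have h2 := hd y hy
    have h3 := norm_sub_le x y
    rw [← Real.norm_eq_abs]
    linarith
  have hdT : ∀ x ∈ T, ∀ y ∈ T, |x - y| ≤ 1 := fun x hx y hy => by
    have := hTI hx
    have := hTI hy
    simp only [Set.mem_Icc] at *
    rw [abs_le]
    constructor <;> linarith
  set q : ℝ := r ^ X.step with hq
  have hq0 : 0 < q := pow_pos h.pos _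
  have hq1 : q < 1 := pow_lt_one₀ h.pos.le h.lt_one X.step_pos.ne'
  have hqκ : ∀ κ : ℕ, r ^ (κ * X.step) = q ^ κ := fun κ => by rw [hq, ← pow_mul, mul_comm]
  -- Touching pieces of `T` correspond to pieces of `D` with a common ancestor only one level
  -- coarser, which costs the factor `1 / q`.
  set C : ℝ := max 1 (d / q) with hC
  have hC1 : 1 ≤ C := le_max_left _ _
  have hCd : d / q ≤ C := le_max_right _ _
  have hCd' : d ≤ C := (le_div_self hd0.le hq0 hq1.le).trans hCd
  set c := min η₁ η₂ with hc
  have hc0 : 0 < c := lt_min hη₁ hη₂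
  set S : ℕ → ℝ → ℝ → Prop := fun κ x y => ∃ w v, X.Matching κ w v ∧ x ∈ wordMap f v '' D ∧
    y ∈ wordMap (affineFamily r k t) w '' T with hS
  have near : ∀ κ x y x' y', S κ x y → S κ x' y' → (κ = 0 ∨ |x - x'| < c * q ^ κ) →
      |y - y'| ≤ 1 * q ^ κ := by
    rintro κ x y x' y' ⟨w, v, hm, hx, hy⟩ ⟨w', v', hm', hx', hy'⟩ hlt
    have hv : v = v' := by
      rcases hlt with rfl | hlt
      · rw [hm.2, hm'.2]
      · refine hsep _ v v' hm.isCut.2.1 hm'.isCut.2.1 x hx x' hx' (hlt.trans_le ?_)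
        rw [hqκ]
        exact mul_le_mul_of_nonneg_right (min_le_left _ _) (pow_pos hq0 κ).le
    subst hv
    obtain rfl := hm.left_unique h hm'
    rw [← hqκ]
    exact dist_le_of_mem_image_wordMap h.pos h.lt_one hfT hdT hm.isCut.1 hy hy'
  have near' : ∀ κ x y x' y', S κ x y → S κ x' y' → (κ = 0 ∨ |y - y'| < c * q ^ κ) →
      |x - x'| ≤ C * q ^ κ := by
    rintro κ x y x' y' ⟨w, v, hm, hx, hy⟩ ⟨w', v', hm', hx', hy'⟩ hlt
    have hsame : v = v' → |x - x'| ≤ C * q ^ κ := by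
      rintro rfl
      have h1 := dist_le_of_mem_image_wordMap h.pos h.lt_one hf hd hm.isCut.2.1 hx hx'
      rw [hqκ] at h1
      exact h1.trans (by gcongr)
    rcases κ with _ | κ
    · exact hsame (by rw [hm.2, hm'.2])
    have hlt := hlt.resolve_left (Nat.succ_ne_zero κ)
    have hcommon : ∀ v₀, IsCut k (κ * X.step) v₀ → v₀ <+: v → v₀ <+: v' →
        |x - x'| ≤ C * q ^ (κ + 1) := by
      rintro v₀ hv₀ ⟨s, rfl⟩ ⟨s', rfl⟩
      have h1 := dist_le_of_mem_image_wordMap h.pos h.lt_one hf hd hv₀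
        (mem_image_wordMap_of_append hD hx) (mem_image_wordMap_of_append hD hx')
      rw [hqκ] at h1
      calc |x - x'| ≤ d * q ^ κ := h1
        _ = d / q * q ^ (κ + 1) := by field_simp; ring
        _ ≤ _ := by gcongr
    rcases htouch _ w w' hm.isCut.1 hm'.isCut.1 y (Set.image_mono hTI hy) y'
      (Set.image_mono hTI hy') (hlt.trans_le (by
        rw [hqκ]
        exact mul_le_mul_of_nonneg_right (min_le_right _ _) (pow_pos hq0 _).le))
      with rfl | ht | ht
    · exact hsame (hm.right_unique h hm')
    · obtain ⟨v₀, h0, h1, h2⟩ := hm.exists_common_prefix h hm' ht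
      exact hcommon v₀ h0 h1 h2
    · obtain ⟨v₀, h0, h1, h2⟩ := hm'.exists_common_prefix h hm ht
      exact hcommon v₀ h0 h2 h1
  have hzero : ∀ (κ : ℕ) (z : ℝ), |z - z| < c * q ^ κ := fun κ z => by
    simpa using mul_pos hc0 (pow_pos hq0 κ)
  have hmeet : ∀ u u' : List ι, (u = u' ∨ Touch r k t u u' ∨ Touch r k t u' u) →
      ∃ p, p ∈ wordMap (affineFamily r k t) u '' T ∧ p ∈ wordMap (affineFamily r k t) u' '' T := by
    rintro u u' (rfl | ht | ht)
    · exact ⟨_, ⟨0, hT0, rfl⟩, ⟨0, hT0, rfl⟩⟩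
    · exact ⟨_, ⟨1, hT1, rfl⟩, ⟨0, hT0, ht.symm⟩⟩
    · exact ⟨_, ⟨0, hT0, rfl⟩, ⟨1, hT1, ht⟩⟩
  refine lipschitzEquivalent_of_correspondences (S := S) (c := c) (C := 2 * C) (q := q)
    hDc.isClosed hTc.isClosed hc0 (by linarith) hq0 hq1 ?_ ?_ ?_ ?_ ?_ ?_ ?_
  · rintro κ x y ⟨w, v, -, ⟨x, hx, rfl⟩, ⟨y, hy, rfl⟩⟩
    exact ⟨wordMap_mem hD v hx, wordMap_mem hT w hy⟩
  · intro κ x hx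
    obtain ⟨v, hv, hxv⟩ := exists_isCut_of_mem hD h.weight_pos (κ * X.step) hx
    obtain ⟨w, hw⟩ := ExchangeData.exists_matching_right hv
    exact ⟨_, w, v, hw, hxv, ⟨0, hT0, rfl⟩⟩
  · intro κ y hy
    obtain ⟨w, hw, hyw⟩ := exists_isCut_of_mem hT h.weight_pos (κ * X.step) hy
    obtain ⟨v, hv⟩ := ExchangeData.exists_matching_left hw
    exact ⟨_, w, v, hv, ⟨_, hDne.some_mem, rfl⟩, hyw⟩
  · intro κ x y x' y' h1 h2 h3
    exact (near κ x y x' y' h1 h2 h3).trans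
      (mul_le_mul_of_nonneg_right (by linarith) (pow_pos hq0 κ).le)
  · intro κ x y x' y' h1 h2 h3
    exact (near' κ x y x' y' h1 h2 h3).trans
      (mul_le_mul_of_nonneg_right (by linarith) (pow_pos hq0 κ).le)
  · rintro κ x y y' h1 ⟨w', v', hm', hx', hy'⟩
    obtain ⟨u, u', v₀, s, s', rfl, rfl, hu, hm₀, hrel⟩ := hm'.exists_parent
    obtain ⟨p, hp, hp'⟩ := hmeet u u' hrel
    have h2 := near κ x y x p h1 ⟨u', v₀, hm₀, mem_image_wordMap_of_append hD hx', hp'⟩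
      (Or.inr (hzero κ x))
    have h3 := dist_le_of_mem_image_wordMap h.pos h.lt_one hfT hdT hu hp
      (mem_image_wordMap_of_append hT hy')
    rw [hqκ] at h3
    calc |y - y'| ≤ |y - p| + |p - y'| := abs_sub_le _ _ _
      _ ≤ 1 * q ^ κ + 1 * q ^ κ := add_le_add h2 h3
      _ = 2 * 1 * q ^ κ := by ring
      _ ≤ _ := by gcongr
  · rintro κ x x' y h1 ⟨w', v', hm', hx', hy'⟩
    obtain ⟨u, u', v₀, s, s', rfl, rfl, hu, hm₀, hrel⟩ := hm'.exists_parent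
    obtain ⟨p, hp, hp'⟩ := hmeet u u' hrel
    -- The partner `v` of `u` is an intermediate stop: `near'` compares `x` with it through `y`, and
    -- it with `x'` through the common point `p` of `u` and `u'`.
    obtain ⟨v, hv⟩ := ExchangeData.exists_matching_left hu
    have hz : wordMap f v hDne.some ∈ wordMap f v '' D := ⟨_, hDne.some_mem, rfl⟩
    have h2 := near' κ x y _ y h1 ⟨u, v, hv, hz, mem_image_wordMap_of_append hT hy'⟩
      (Or.inr (hzero κ y))
    have h3 := near' κ _ p x' p ⟨u, v, hv, hz, hp⟩
      ⟨u', v₀, hm₀, mem_image_wordMap_of_append hD hx', hp'⟩ (Or.inr (hzero κ p))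
    calc |x - x'| ≤ |x - wordMap f v hDne.some| + |wordMap f v hDne.some - x'| :=
          abs_sub_le _ _ _
      _ ≤ C * q ^ κ + C * q ^ κ := add_le_add h2 h3
      _ = _ := by ring

theorem wordWeight_flatten_replicate {ι : Type*} (k : ι → ℕ) (m : ℕ) (u : List ι) :
    wordWeight k (List.replicate m u).flatten = m * wordWeight k u := by
  induction m with
  | zero => simp
  | succ m ih => simp [List.replicate_succ, ih]; ring

/-- The required weight depends on `u` and `v` only through the difference of their weights. For cut
words of one level this takes finitely many values, so one `step` serves all pairs and levels. -/
theorem IsArrangement.nonempty_exchangeData {r : ℝ} {k : ι → ℕ} {t : ι → ℝ}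
    (h : IsArrangement r k t) (left right : ι) (hlt : ∀ a, a < right ↔ a ≤ left)
    (hgap : ∀ a b, a ≤ left → right ≤ b → r ^ k a + t a < t b) :
    Nonempty (ExchangeData r k t) := by
  obtain ⟨M, hM⟩ : ∃ M, ∀ a, k a ≤ M := by
    obtain ⟨M, hM⟩ := (Set.finite_range k).bddAbove
    exact ⟨M, fun a => hM ⟨a, rfl⟩⟩
  have hex : ∀ d : ℤ, ∃ (j : List ι) (m : ℕ), 0 < m ∧
      ((∃ u v : List ι, (wordWeight k v : ℤ) - wordWeight k u = d) →
        (wordWeight k (right :: j ++ [right]) : ℤ) = d + m * k ⊥) := by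
    intro d
    by_cases hd : ∃ u v : List ι, (wordWeight k v : ℤ) - wordWeight k u = d
    · obtain ⟨u, v, rfl⟩ := hd
      -- With the two framing letters, the weight is that of `v`, plus `k ⊥ - 1` times that of `u`,
      -- plus `2 * k ⊥ * k right`; this is the difference `d` plus `k ⊥` times the chosen `m`.
      refine ⟨v ++ (List.replicate (k ⊥ - 1) u).flatten ++ List.replicate (2 * (k ⊥ - 1)) right,
        wordWeight k u + 2 * k right, by have := h.weight_pos right; omega, fun _ => ?_⟩
      obtain ⟨b, hb⟩ := Nat.exists_eq_succ_of_ne_zero (h.weight_pos ⊥).ne'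
      simp only [wordWeight_append, wordWeight_cons, wordWeight_nil, wordWeight_replicate,
        wordWeight_flatten_replicate, hb]
      simp
      ring
    · exact ⟨[], 1, one_pos, fun h => absurd h hd⟩
  choose j m hm hj using hex
  refine ⟨{
    left := left
    right := right
    lt_right_iff := hlt
    gap := hgap
    inner := fun u v => j ((wordWeight k v : ℤ) - wordWeight k u)
    reps := fun u v => m ((wordWeight k v : ℤ) - wordWeight k u)
    step := M + (Finset.Icc (-(M : ℤ)) M).sup (fun d => m d * k ⊥) + 1
    maxWeight := M
    weight_le := hM
    step_pos := by omega
    reps_pos := fun u v => hm _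
    weight_eq := fun K u v _ _ _ => ?_
    lt_step := fun K u v hu hv _ => ?_ }⟩
  · have := hj _ ⟨u, v, rfl⟩
    zify
    linarith
  · have h1 := hu.wordWeight_le hM
    have h2 := hv.wordWeight_le hM
    have h3 := hu.1
    have h4 := hv.1
    have h5 := Finset.le_sup (f := fun d => m d * k ⊥)
      (Finset.mem_Icc.2 (⟨by omega, by omega⟩ :
        -(M : ℤ) ≤ (wordWeight k v : ℤ) - wordWeight k u ∧
          (wordWeight k v : ℤ) - wordWeight k u ≤ M))
    omega

end Main

/-! ### Reduction to integer weights and existence of a gap -/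

/-- Numbers in `(0, 1)` with commensurable logarithms are powers of one number. -/
theorem exists_eq_pow_of_log_commensurable {ι : Type*} [Fintype ι] [Nonempty ι] {ρ : ι → ℝ}
    (h0 : ∀ i, 0 < ρ i) (h1 : ∀ i, ρ i < 1)
    (hlog : ∀ i j, ∃ q : ℚ, Real.log (ρ i) / Real.log (ρ j) = (q : ℝ)) :
    ∃ (r : ℝ) (k : ι → ℕ), 0 < r ∧ r < 1 ∧ (∀ i, 0 < k i) ∧ ∀ i, ρ i = r ^ k i := by
  obtain ⟨i₀⟩ := ‹Nonempty ι›
  have hneg : ∀ i, Real.log (ρ i) < 0 := fun i => Real.log_neg (h0 i) (h1 i)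
  choose q hq using fun i => hlog i i₀
  have hqpos : ∀ i, 0 < q i := fun i => by
    have := div_pos_of_neg_of_neg (hneg i) (hneg i₀)
    rw [hq] at this
    exact_mod_cast this
  set d : ℕ := ∏ i, (q i).den with hd
  have hd0 : 0 < d := Finset.prod_pos fun i _ => (q i).pos
  have hk : ∀ i, ∃ k : ℕ, (k : ℚ) = q i * d := by
    intro i
    obtain ⟨e, he⟩ : (q i).den ∣ d := Finset.dvd_prod_of_mem _ (Finset.mem_univ i)
    refine ⟨(q i).num.toNat * e, ?_⟩
    have hn : (((q i).num.toNat : ℤ) : ℚ) = (q i).num := by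
      rw [Int.toNat_of_nonneg (Rat.num_pos.2 (hqpos i)).le]
    rw [he]
    push_cast at hn ⊢
    rw [hn, ← mul_assoc, Rat.mul_den_eq_num]
  choose k hk using hk
  have hd0' : (0 : ℝ) < d := by exact_mod_cast hd0
  -- The base is the `d`-th root of `ρ i₀`, where `d` is a common multiple of the denominators of
  -- the log ratios.
  refine ⟨Real.exp (Real.log (ρ i₀) / d), k, Real.exp_pos _, ?_, fun i => ?_, fun i => ?_⟩
  · rw [Real.exp_lt_one_iff]
    exact div_neg_of_neg_of_pos (hneg i₀) hd0'
  · have : (0 : ℚ) < k i := by rw [hk]; exact mul_pos (hqpos i) (by exact_mod_cast hd0)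
    exact_mod_cast this
  · rw [← Real.exp_nat_mul]
    have hk' : (k i : ℝ) = q i * d := by exact_mod_cast hk i
    have hq' : Real.log (ρ i) = q i * Real.log (ρ i₀) := by
      rw [← hq i, div_mul_cancel₀ _ (hneg i₀).ne]
    rw [hk', show (q i : ℝ) * d * (Real.log (ρ i₀) / d) = q i * Real.log (ρ i₀) by field_simp,
      ← hq', Real.exp_log (h0 i)]

/-- If the total length is less than one, two consecutive intervals do not touch. -/
theorem exists_gap {n : ℕ} {ρ t : Fin n → ℝ} (hn : 0 < n) (hρ : ∑ i, ρ i < 1)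
    (ht : IsTouchingArrangement ρ t) :
    ∃ i j : Fin n, (j : ℕ) = i + 1 ∧ ρ i + t i < t j := by
  by_contra! hno
  -- Without gaps the left ends are the partial sums of the lengths, so the last right end, which is
  -- `1`, equals the total length.
  have key : ∀ m (hm : m < n),
      t ⟨m, hm⟩ = ∑ l ∈ Finset.range m, if h : l < n then ρ ⟨l, h⟩ else 0 := by
    intro m
    induction m with
    | zero => intro hm; simpa [affineMaps] using ht.first ⟨0, hm⟩ rfl
    | succ m ih =>
      intro hm
      have h1 := hno ⟨m, by omega⟩ ⟨m + 1, hm⟩ rfl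
      have h2 := ht.ordered ⟨m, by omega⟩ ⟨m + 1, hm⟩ (by simp [Fin.lt_def])
      simp only [affineMaps, mul_one, mul_zero, zero_add] at h2
      rw [Finset.sum_range_succ, ← ih (by omega), dif_pos (show m < n by omega)]
      linarith
  obtain ⟨m, rfl⟩ := Nat.exists_eq_succ_of_ne_zero hn.ne'
  have h1 := ht.last ⟨m, by omega⟩ rfl
  have h2 : ∑ l ∈ Finset.range (m + 1), (if h : l < m + 1 then ρ ⟨l, h⟩ else 0) = ∑ i, ρ i := by
    rw [Finset.sum_range]
    exact Finset.sum_congr rfl fun i _ => dif_pos i.2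
  rw [Finset.sum_range_succ, ← key m (by omega), dif_pos (show m < m + 1 by omega)] at h2
  simp only [affineMaps, mul_one] at h1
  linarith

theorem theorem1p4 (n : ℕ) (hn : 3 ≤ n) (ρ : Fin n → ℝ) (hρ : IsContractionVector ρ)
    (D : Set ℝ) (hD : IsDustLike ρ D)
    (t : Fin n → ℝ) (ht : IsTouchingArrangement ρ t)
    (T : Set ℝ) (hT : IsAttractor (affineMaps ρ t) T)
    (hlog : ∀ i j : Fin n, ∃ q : ℚ, Real.log (ρ i) / Real.log (ρ j) = (q : ℝ)) :
    LipschitzEquivalent D T := by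
  have : NeZero n := ⟨by omega⟩
  obtain ⟨r, k, hr, hr1, hk, hρk⟩ := exists_eq_pow_of_log_commensurable hρ.pos hρ.lt_one hlog
  obtain ⟨i, j, hij, hgap⟩ := exists_gap (by omega) hρ.sum_lt_one ht
  obtain rfl : ρ = fun i => r ^ k i := funext hρk
  have hord : ∀ a b : Fin n, a < b → r ^ k a + t a ≤ t b := fun a b hab => by
    simpa [affineMaps] using ht.ordered a b hab
  have h : IsArrangement r k t :=
    { pos := hr
      lt_one := hr1
      weight_pos := hk
      ordered := hord
      first := by simpa [affineMaps] using ht.first ⊥ rfl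
      last := by
        have := ht.last ⊤ (by rw [Fin.val_top]; omega)
        simpa [affineMaps] using this }
  have hpos : ∀ a, 0 < r ^ k a := fun a => pow_pos hr _
  obtain ⟨X⟩ := h.nonempty_exchangeData i j (fun a => by rw [Fin.lt_def, Fin.le_def]; omega)
    (fun a b ha hb => by
      have h1 : r ^ k a + t a ≤ r ^ k i + t i := by
        rcases ha.eq_or_lt with rfl | ha
        · exact le_rfl
        · linarith [hord a i ha, hpos i]
      have h2 : t j ≤ t b := by
        rcases hb.eq_or_lt with rfl | hb
        · exact le_rfl
        · linarith [hord j b hb, hpos j]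
      exact (h1.trans_lt hgap).trans_le h2)
  obtain ⟨φ, hφ, hDφ, hdisj⟩ := hD
  exact X.lipschitzEquivalent h hφ hDφ.nonempty hDφ.isCompact hDφ.iUnion_image_eq hdisj
    hT.nonempty hT.isCompact hT.iUnion_image_eq
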